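/- **Conventions.** For a cardinal $\theta$, $H(\theta)$ is the set of all sets whose transitive closure has cardinality $<\theta$; $M\preceq (H(\theta),\in)$ means that $M\subseteq H(\theta)$ and $(M,\in)$ is an elementary substructure of $(H(\theta),\in)$ in the first-order language of set theory. For a compact Hausdorff space $K$ (viewed as a set, namely as the pair of its underlying set and its topology) and $M\preceq (H(\theta),\in)$, let $x\sim_M y$ if $f(x)=f(y)$ for every continuous $f\colon K\to\mathbb R$ with $f\in M$; $K/M$ is the quotient $K/{\sim_M}$ and $q^M\colon K\to K/M$ is the quotient map. A set $D\subseteq K$ is countably closed if $\operatorname{cl}(A)\subseteq D$ for every countable $A\subseteq D$. A retractional skeleton in $K$ is a family $\{r_s\}_{s\in\Gamma}$ of continuous retractions of $K$ onto metrizable subsets, indexed by a nonempty up-directed partially ordered set $\Gamma$, such that 1. $s\le t$ implies $r_s=r_s\circ r_t=r_t\circ r_s$; 2. $x=\lim_{s\in\Gamma}r_s(x)$ for every $x\in K$; 3. whenever $s_0<s_1<\cdots$ in $\Gamma$, the supremum $t=\sup_n s_n$ exists in $\Gamma$ and $r_t(x)=\lim_{n\to\infty}r_{s_n}(x)$ for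 every $x\in K$. It induces $D$ if $D=\bigcup_{s\in\Gamma}r_s[K]$. **Theorem.** Let $K$ be a compact Hausdorff space and let $D\subseteq K$ be a dense countably closed set. The following are equivalent: (a) $K$ has a retractional skeleton which induces $D$. (b) For every sufficiently big cardinal $\theta$ (that is, there is $\theta_0$ such that for all cardinals $\theta\ge\theta_0$) and every countable $M\preceq (H(\theta),\in)$ with $K,D\in M$, the restriction of $q^M\colon K\to K/M$ to $\operatorname{cl}(D\cap M)$ is one-to-one. -/

import Mathlib

open Topology Filter

universe u v

/-! ### Retractional skeletons -/

/-- A family `r : Γ → (K → K)` is a retractional skeleton in `K`, where `Γ` is an up-directed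
partially ordered set: each `r s` is a continuous retraction of `K` onto a metrizable subset, and
(1) `r s = r s ∘ r t = r t ∘ r s` whenever `s ≤ t`;
(2) every `x` is the limit of the net `(r s x)`;
(3) every strictly increasing sequence `s₀ < s₁ < ⋯` has a supremum `t` in `Γ`, and
`r t x = lim r (s n) x` for every `x`. -/
structure IsRetractionalSkeleton {K : Type u} [TopologicalSpace K] {Γ : Type v} [PartialOrder Γ]
    (r : Γ → K → K) : Prop where
  nonempty : Nonempty Γ
  directed : ∀ s t : Γ, ∃ w : Γ, s ≤ w ∧ t ≤ w
  continuous : ∀ s, Continuous (r s)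
  retraction : ∀ s x, r s (r s x) = r s x
  metrizable : ∀ s, TopologicalSpace.MetrizableSpace (Set.range (r s))
  compatible : ∀ s t, s ≤ t → r s = r s ∘ r t ∧ r s = r t ∘ r s
  tendsto_id : ∀ x, Tendsto (fun s => r s x) atTop (𝓝 x)
  exists_sup : ∀ s : ℕ → Γ, StrictMono s →
    ∃ t, IsLUB (Set.range s) t ∧ ∀ x, Tendsto (fun n => r (s n) x) atTop (𝓝 (r t x))

/-- `K` has a retractional skeleton which induces `D`, i.e. a retractional skeleton
`(r s)` with `D = ⋃ s, r s [K]`. -/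
def IsInducedByRetractionalSkeleton {K : Type u} [TopologicalSpace K] (D : Set K) : Prop :=
  ∃ (Γ : Type u) (_ : PartialOrder Γ) (r : Γ → K → K),
    IsRetractionalSkeleton r ∧ D = ⋃ s, Set.range (r s)

/-- `D` is countably closed: it contains the closure of each of its countable subsets. -/
def IsCountablyClosed {K : Type u} [TopologicalSpace K] (D : Set K) : Prop :=
  ∀ A : Set K, A ⊆ D → A.Countable → closure A ⊆ D

/-! ### The structures `(H(θ), ∈)` and their elementary substructures -/

/-- The only non-logical symbol of the language of set theory: the binary relation `∈`. -/
inductive SetTheoryRel : ℕ → Type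
  | mem : SetTheoryRel 2

/-- The first-order language of set theory (with equality). -/
def setTheoryLanguage : FirstOrder.Language := ⟨fun _ => Empty, SetTheoryRel⟩

/-- Every set `N` of sets is a structure `(N, ∈)` for the language of set theory. -/
instance memStructure (N : Set ZFSet.{u}) : setTheoryLanguage.Structure N where
  funMap := fun f => Empty.elim f
  RelMap := fun R x => match R, x with
    | SetTheoryRel.mem, x => (x 0 : ZFSet.{u}) ∈ (x 1 : ZFSet.{u})

namespace ZFSet

/-- The transitive closure `x ∪ ⋃ x ∪ ⋃ ⋃ x ∪ ⋯` of a set `x`. -/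
noncomputable def trClosure (x : ZFSet.{u}) : ZFSet.{u} :=
  ZFSet.iUnion fun n : ℕ => (ZFSet.sUnion)^[n] x

/-- `H(θ)`: the collection of all sets whose transitive closure has cardinality `< θ`. -/
def H (θ : Cardinal.{u}) : Set ZFSet.{u} := {x | (trClosure x).card < θ}

/-! ### Topological spaces and real-valued functions as sets -/

/-- The natural number `n` as a set: the von Neumann ordinal `{0, …, n - 1}`. -/
noncomputable def natCode : ℕ → ZFSet.{u}
  | 0 => ∅
  | n + 1 => insert (natCode n) (natCode n)

/-- The integer `z` as a set: the pair `(max z 0, max (-z) 0)` of natural numbers. -/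
noncomputable def intCode (z : ℤ) : ZFSet.{u} := pair (natCode z.toNat) (natCode (-z).toNat)

/-- The rational number `q` as a set: the pair (numerator, denominator) in lowest terms. -/
noncomputable def ratCode (q : ℚ) : ZFSet.{u} := pair (intCode q.num) (natCode q.den)

/-- The real number `a` as a set: the Dedekind cut `{q ∈ ℚ : q < a}`. -/
noncomputable def realCode (a : ℝ) : ZFSet.{u} :=
  range fun q : {q : ℚ // (q : ℝ) < a} => ratCode q.1

variable {K : Type u} (e : K ↪ ZFSet.{u})

/-- `A ⊆ K` as a set, the point `x : K` being the set `e x`. -/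
noncomputable def subsetCode (A : Set K) : ZFSet.{u} := range fun x : A => e x

/-- The topological space `K` as a set: the pair consisting of its underlying set and of its
topology (the set of all open subsets). -/
noncomputable def spaceCode [TopologicalSpace K] : ZFSet.{u} :=
  pair (subsetCode e Set.univ) (range fun U : TopologicalSpace.Opens K => subsetCode e U)

/-- The function `f : K → ℝ` as a set of ordered pairs. -/
noncomputable def funCode (f : K → ℝ) : ZFSet.{u} := range fun x : K => pair (e x) (realCode (f x))

end ZFSet

/-! ### The quotient `K / M` -/

section Quotient

variable {θ : Cardinal.{u}} (M : setTheoryLanguage.ElementarySubstructure (ZFSet.H θ))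

/-- The elements of an elementary substructure `M` of `H(θ)`, as a collection of sets. -/
def modelSets : Set ZFSet.{u} := {x | ∃ h : x ∈ ZFSet.H θ, (⟨x, h⟩ : ZFSet.H θ) ∈ M}

variable {K : Type u} [TopologicalSpace K] (e : K ↪ ZFSet.{u})

/-- `x ∼_M y` iff `f x = f y` for every `f ∈ C(K) ∩ M`. -/
def modelSetoid : Setoid K where
  r x y := ∀ f : C(K, ℝ), ZFSet.funCode e f ∈ modelSets M → f x = f y
  iseqv := ⟨fun _ _ _ => rfl, fun h f hf => (h f hf).symm,
    fun h₁ h₂ f hf => (h₁ f hf).trans (h₂ f hf)⟩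

/-- The canonical quotient map `q^M : K → K / M`, where `K / M` is `K / ∼_M`. -/
def modelQuotientMap : K → Quotient (modelSetoid M e) := Quotient.mk (modelSetoid M e)

/-- `D ∩ M`, the set of all points of `D` which are elements of `M`. -/
def modelPoints (D : Set K) : Set K := {x | x ∈ D ∧ e x ∈ modelSets M}

end Quotient

/-! From skeleton to models. The part of a skeleton needed to separate points is coded by four sets:
the indices, their order, the relation "`d` lies in the range of `r s`", and for each index a
sequence of continuous functions separating the points of the metrizable range. Being such a code is
a first-order property with parameters `K` and `D`, so by elementarity some code lies in `M`
(`exists_isSkeletonCode`, `definablePred_isSkeletonCode`). The indices in `M` form a countable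
directed set whose ranges cover `D ∩ M`. In a skeleton such a set has an upper bound `t` for which
`r t` fixes the closure of these ranges and is determined by the smaller retractions
(`eq_of_forall_apply_eq`). Hence distinct points of `cl(D ∩ M)` are separated by one of the coded
functions, and that function is definable from elements of `M`, so it lies in `M`
(`injOn_of_isSkeletonCode`).

From models to skeleton. One large `θ` suffices. The indices are the countable elementary submodels
containing `K` and `D`, ordered by inclusion. Density of `D`, elementarity and compactness show that
`q^M` maps `cl(D ∩ M)` onto `K/M` (`exists_mem_closure_modelPoints`). By hypothesis this restriction
is also injective, so `r_M x` can be taken as the only point of `cl(D ∩ M)` on which all functions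
in `M` have the same values as at `x`. Compactness yields continuity and both limit conditions
(`exists_isRetractionalSkeleton`). Suprema of chains are unions, and countable closedness keeps the
ranges inside `D`.

For the first direction, continuous real functions must be recognisable inside `H(θ)`; this is the
role of the first-order descriptions of rationals, reals and continuity, culminating in
`isCont_iff`. -/

/-! ### Definable predicates over an elementary substructure of `H(θ)` -/

section Definability

open FirstOrder FirstOrder.Language

variable {θ : Cardinal.{u}} (M : setTheoryLanguage.ElementarySubstructure (ZFSet.H θ))

/-- `P` is definable in `(H(θ), ∈)` by a formula with parameters from `M`. -/
def DefinablePred {V : Type*} (P : (V → ZFSet.H θ) → Prop) : Prop :=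
  (M : Set (ZFSet.H θ)).Definable setTheoryLanguage {w | P w}

/-- The function `t` has a graph which is definable with parameters from `M`. -/
def DefinableTerm {V : Type*} (t : (V → ZFSet.H θ) → ZFSet.H θ) : Prop :=
  DefinablePred M fun w : Option V → ZFSet.H θ => w none = t fun v => w (some v)

variable {M} {V : Type*}

namespace DefinablePred

variable {P Q : (V → ZFSet.H θ) → Prop}

theorem and (hP : DefinablePred M P) (hQ : DefinablePred M Q) :
    DefinablePred M fun w => P w ∧ Q w :=
  Set.Definable.inter hP hQ

theorem or (hP : DefinablePred M P) (hQ : DefinablePred M Q) :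
    DefinablePred M fun w => P w ∨ Q w :=
  Set.Definable.union hP hQ

theorem not (hP : DefinablePred M P) : DefinablePred M fun w => ¬ P w :=
  Set.Definable.compl hP

theorem congr (hP : DefinablePred M P) (h : ∀ w, Q w ↔ P w) : DefinablePred M Q := by
  have : Q = P := funext fun w => propext (h w)
  rwa [this]

theorem imp (hP : DefinablePred M P) (hQ : DefinablePred M Q) :
    DefinablePred M fun w => P w → Q w :=
  (hP.not.or hQ).congr fun _ => imp_iff_not_or

theorem iff (hP : DefinablePred M P) (hQ : DefinablePred M Q) :
    DefinablePred M fun w => P w ↔ Q w :=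
  ((hP.imp hQ).and (hQ.imp hP)).congr fun _ => iff_iff_implies_and_implies

theorem true : DefinablePred M fun _ : V → ZFSet.H θ => True :=
  Set.definable_univ

theorem forall_finset {ι : Type*} (s : Finset ι) {R : ι → (V → ZFSet.H θ) → Prop}
    (h : ∀ i ∈ s, DefinablePred M (R i)) : DefinablePred M fun w => ∀ i ∈ s, R i w := by
  classical
  induction s using Finset.induction_on with
  | empty => exact true.congr fun w => by simp
  | insert a s _ ih =>
    exact ((h a (by simp)).and (ih fun i hi => h i (by simp [hi]))).congr fun w => by simp

theorem relabel {V' : Type*} (f : V → V') (hP : DefinablePred M P) :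
    DefinablePred M fun w : V' → ZFSet.H θ => P fun v => w (f v) :=
  Set.Definable.preimage_comp f hP

theorem exists_finite {W : Type*} [Finite W] {R : (V ⊕ W → ZFSet.H θ) → Prop}
    (h : DefinablePred M R) : DefinablePred M fun w : V → ZFSet.H θ => ∃ y, R (Sum.elim w y) :=
  Set.Definable.exists_of_finite h

theorem ex {R : (V → ZFSet.H θ) → ZFSet.H θ → Prop}
    (h : DefinablePred M fun w : Option V → ZFSet.H θ => R (fun v => w (some v)) (w none)) :
    DefinablePred M fun w => ∃ x, R w x := by
  refine (exists_finite (W := Unit)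
    (h.relabel fun o : Option V => o.elim (Sum.inr ()) Sum.inl)).congr fun w => ?_
  exact ⟨fun ⟨x, hx⟩ => ⟨fun _ => x, hx⟩, fun ⟨y, hy⟩ => ⟨y (), hy⟩⟩

theorem all {R : (V → ZFSet.H θ) → ZFSet.H θ → Prop}
    (h : DefinablePred M fun w : Option V → ZFSet.H θ => R (fun v => w (some v)) (w none)) :
    DefinablePred M fun w => ∀ x, R w x :=
  (ex (R := fun w x => ¬ R w x) h.not).not.congr fun w => by simp

theorem eq_var (i j : V) : DefinablePred M fun w : V → ZFSet.H θ => w i = w j :=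
  ⟨(Term.var i).equal (Term.var j), by ext; simp⟩

theorem eq_const (i : V) {c : ZFSet.H θ} (hc : c ∈ M) :
    DefinablePred M fun w : V → ZFSet.H θ => w i = c :=
  relabel (P := fun w : Fin 1 → ZFSet.H θ => w 0 = c) (fun _ => i)
    (Set.Definable.singleton_of_mem setTheoryLanguage (A := (M : Set (ZFSet.H θ))) hc)

theorem mem_var (i j : V) : DefinablePred M fun w : V → ZFSet.H θ => (w i).1 ∈ (w j).1 := by
  refine Set.definable_iff_exists_formula_sum.2
    ⟨Relations.formula₂ (L := setTheoryLanguage) SetTheoryRel.mem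
      (Term.var (Sum.inr i)) (Term.var (Sum.inr j)), ?_⟩
  rfl

end DefinablePred

namespace DefinableTerm

theorem var (i : V) : DefinableTerm M fun w : V → ZFSet.H θ => w i :=
  DefinablePred.eq_var none (some i)

theorem const {c : ZFSet.H θ} (hc : c ∈ M) : DefinableTerm M fun _ : V → ZFSet.H θ => c :=
  DefinablePred.eq_const none hc

end DefinableTerm

/-- Definable terms may be substituted into definable predicates. -/
theorem DefinablePred.subst {n : ℕ} {R : (Fin n → ZFSet.H θ) → Prop} (hR : DefinablePred M R)
    (t : Fin n → (V → ZFSet.H θ) → ZFSet.H θ) (ht : ∀ i, DefinableTerm M (t i)) :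
    DefinablePred M fun w => R fun i => t i w := by
  have h : ∀ i : Fin n, DefinablePred M fun w : V ⊕ Fin n → ZFSet.H θ =>
      w (Sum.inr i) = t i fun v => w (Sum.inl v) := fun i =>
    DefinablePred.relabel (fun o : Option V => o.elim (Sum.inr i) Sum.inl) (ht i)
  -- A definable `t i` need not be a term of the language, so its value is named by a quantified
  -- variable constrained by the graph.
  refine (exists_finite ((forall_finset Finset.univ fun i _ => h i).and
    (hR.relabel Sum.inr))).congr fun w => ?_
  constructor
  · exact fun hw => ⟨fun i => t i w, fun i _ => rfl, hw⟩
  · rintro ⟨y, hy, hR⟩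
    have : y = fun i => t i w := funext fun i => hy i (Finset.mem_univ _)
    rwa [← this]

theorem DefinablePred.subst₁ {R : ZFSet.H θ → Prop}
    (hR : DefinablePred M fun w : Fin 1 → ZFSet.H θ => R (w 0))
    {a : (V → ZFSet.H θ) → ZFSet.H θ} (ha : DefinableTerm M a) :
    DefinablePred M fun w => R (a w) :=
  hR.subst ![a] (by simpa [Fin.forall_fin_succ] using ha)

theorem DefinablePred.subst₂ {R : ZFSet.H θ → ZFSet.H θ → Prop}
    (hR : DefinablePred M fun w : Fin 2 → ZFSet.H θ => R (w 0) (w 1))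
    {a b : (V → ZFSet.H θ) → ZFSet.H θ} (ha : DefinableTerm M a) (hb : DefinableTerm M b) :
    DefinablePred M fun w => R (a w) (b w) :=
  hR.subst ![a, b] (by simpa [Fin.forall_fin_succ] using ⟨ha, hb⟩)

theorem DefinablePred.subst₃ {R : ZFSet.H θ → ZFSet.H θ → ZFSet.H θ → Prop}
    (hR : DefinablePred M fun w : Fin 3 → ZFSet.H θ => R (w 0) (w 1) (w 2))
    {a b c : (V → ZFSet.H θ) → ZFSet.H θ} (ha : DefinableTerm M a) (hb : DefinableTerm M b)
    (hc : DefinableTerm M c) :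
    DefinablePred M fun w => R (a w) (b w) (c w) :=
  hR.subst ![a, b, c] (by simpa [Fin.forall_fin_succ] using ⟨ha, hb, hc⟩)

theorem DefinablePred.subst₄ {R : ZFSet.H θ → ZFSet.H θ → ZFSet.H θ → ZFSet.H θ → Prop}
    (hR : DefinablePred M fun w : Fin 4 → ZFSet.H θ => R (w 0) (w 1) (w 2) (w 3))
    {a b c d : (V → ZFSet.H θ) → ZFSet.H θ} (ha : DefinableTerm M a) (hb : DefinableTerm M b)
    (hc : DefinableTerm M c) (hd : DefinableTerm M d) :
    DefinablePred M fun w => R (a w) (b w) (c w) (d w) :=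
  hR.subst ![a, b, c, d] (by simpa [Fin.forall_fin_succ] using ⟨ha, hb, hc, hd⟩)

namespace DefinablePred

variable {a b : (V → ZFSet.H θ) → ZFSet.H θ}

theorem mem (ha : DefinableTerm M a) (hb : DefinableTerm M b) :
    DefinablePred M fun w => (a w).1 ∈ (b w).1 :=
  subst₂ (R := fun x y => x.1 ∈ y.1) (mem_var 0 1) ha hb

theorem eq (ha : DefinableTerm M a) (hb : DefinableTerm M b) :
    DefinablePred M fun w => a w = b w :=
  subst₂ (R := fun x y => x = y) (eq_var 0 1) ha hb

/-- Elementarity: a definable property which holds somewhere in `H(θ)` holds at an element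
of `M`. -/
theorem exists_mem {R : ZFSet.H θ → Prop}
    (hR : DefinablePred M fun w : Fin 1 → ZFSet.H θ => R (w 0)) (h : ∃ x, R x) :
    ∃ x ∈ M, R x := by
  obtain ⟨x, hx, hxM⟩ := M.meetsDefinable {x | R x} h hR
  exact ⟨x, hxM, hx⟩

/-- An element definable from parameters in `M` lies in `M`, because the only witness of a satisfied
definable property must be the one that elementarity provides. -/
theorem mem_of_unique {R : ZFSet.H θ → Prop}
    (hR : DefinablePred M fun w : Fin 1 → ZFSet.H θ => R (w 0)) {x : ZFSet.H θ} (hx : R x)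
    (h : ∀ y, R y → y = x) : x ∈ M := by
  obtain ⟨y, hy, hRy⟩ := hR.exists_mem ⟨x, hx⟩
  exact h y hRy ▸ hy

end DefinablePred

end Definability

/-! ### The sets `H(θ)` -/

namespace ZFSet

theorem mem_trClosure {x z : ZFSet.{u}} :
    z ∈ trClosure x ↔ ∃ n : ℕ, z ∈ (ZFSet.sUnion)^[n] x := by
  simp [trClosure]

theorem subset_trClosure (x : ZFSet.{u}) : x ⊆ trClosure x := fun _ hz =>
  mem_trClosure.2 ⟨0, hz⟩

theorem isTransitive_trClosure (x : ZFSet.{u}) : (trClosure x).IsTransitive := by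
  intro y hy z hz
  obtain ⟨n, hn⟩ := mem_trClosure.1 hy
  refine mem_trClosure.2 ⟨n + 1, ?_⟩
  rw [Function.iterate_succ_apply', mem_sUnion]
  exact ⟨y, hn, hz⟩

theorem trClosure_subset {x t : ZFSet.{u}} (ht : t.IsTransitive) (h : x ⊆ t) :
    trClosure x ⊆ t := by
  intro z hz
  obtain ⟨n, hn⟩ := mem_trClosure.1 hz
  induction n generalizing z with
  | zero => exact h hn
  | succ n ih =>
    rw [Function.iterate_succ_apply', mem_sUnion] at hn
    obtain ⟨y, hy, hzy⟩ := hn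
    exact ht y (ih (mem_trClosure.2 ⟨n, hy⟩) hy) hzy

variable {θ : Cardinal.{u}} {x y : ZFSet.{u}}

theorem mem_H_of_subset (hx : x ∈ H θ) (h : y ⊆ x) : y ∈ H θ :=
  (card_mono (trClosure_subset (isTransitive_trClosure x)
    (h.trans (subset_trClosure x)))).trans_lt hx

theorem mem_H_of_mem (hx : x ∈ H θ) (h : y ∈ x) : y ∈ H θ :=
  (card_mono (trClosure_subset (isTransitive_trClosure x)
    (isTransitive_trClosure x y (subset_trClosure x h)))).trans_lt hx

theorem insert_mem_H (hθ : Cardinal.aleph0 ≤ θ) (hx : x ∈ H θ) (hy : y ∈ H θ) :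
    insert x y ∈ H θ := by
  have h : trClosure (insert x y) ⊆ insert x (trClosure x ∪ trClosure y) := by
    refine trClosure_subset (fun z hz t ht => ?_) fun z hz => ?_
    · simp only [mem_insert_iff, mem_union] at hz ⊢
      rcases hz with rfl | hz | hz
      · exact Or.inr (Or.inl (subset_trClosure _ ht))
      · exact Or.inr (Or.inl (isTransitive_trClosure x z hz ht))
      · exact Or.inr (Or.inr (isTransitive_trClosure y z hz ht))
    · simp only [mem_insert_iff, mem_union] at hz ⊢
      exact hz.imp id fun hz => Or.inr (subset_trClosure _ hz)
  refine (card_mono h).trans_lt (card_insert_le.trans_lt ?_)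
  exact Cardinal.add_lt_of_lt hθ
    (card_union_le.trans_lt (Cardinal.add_lt_of_lt hθ hx hy))
    (Cardinal.one_lt_aleph0.trans_le hθ)

theorem empty_mem_H (hθ : Cardinal.aleph0 ≤ θ) : (∅ : ZFSet.{u}) ∈ H θ := by
  have h : trClosure (∅ : ZFSet.{u}) ⊆ ∅ :=
    trClosure_subset (fun z hz => absurd hz (notMem_empty z)) fun _ h => h
  refine (card_mono h).trans_lt ?_
  rw [card_empty]
  exact Cardinal.aleph0_pos.trans_le hθ

theorem pair_mem_H (hθ : Cardinal.aleph0 ≤ θ) (hx : x ∈ H θ) (hy : y ∈ H θ) :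
    pair x y ∈ H θ := by
  have hs : ∀ z ∈ H θ, ({z} : ZFSet.{u}) ∈ H θ := fun z hz => by
    rw [← LawfulSingleton.insert_empty_eq]
    exact insert_mem_H hθ hz (empty_mem_H hθ)
  exact insert_mem_H hθ (hs x hx) (hs _ (insert_mem_H hθ hx (hs y hy)))

theorem mem_H_of_rank_lt {o : Ordinal.{u}} (hx : rank x < o) (hθ : (vonNeumann o).card < θ) :
    x ∈ H θ :=
  (card_mono (trClosure_subset (isTransitive_vonNeumann o)
    (isTransitive_vonNeumann o x (mem_vonNeumann.2 hx)))).trans_lt hθ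

/-- The ranks occurring in a transitive set have no gaps: descend along membership until the rank is
exactly `o`. -/
theorem exists_mem_rank_eq {t : ZFSet.{u}} (ht : t.IsTransitive) (x : ZFSet.{u}) (hx : x ⊆ t)
    {o : Ordinal.{u}} (ho : o < rank x) : ∃ y ∈ t, rank y = o := by
  induction x using ZFSet.inductionOn with
  | _ x ih =>
    obtain ⟨y, hy, hoy⟩ := lt_rank_iff.1 ho
    rcases hoy.eq_or_lt with rfl | hlt
    · exact ⟨y, hx hy, rfl⟩
    · exact ih y hy (ht y (hx hy)) hlt

theorem card_rank_le (x : ZFSet.{u}) : (rank x).card ≤ (trClosure x).card := by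
  have h : Set.Iio (rank x) ⊆ rank '' (trClosure x : Set ZFSet.{u}) := fun o ho =>
    exists_mem_rank_eq (isTransitive_trClosure x) x (subset_trClosure x) ho
  have h' := (Cardinal.mk_le_mk_of_subset h).trans Cardinal.mk_image_le
  rw [Cardinal.mk_Iio_ordinal] at h'
  exact Cardinal.lift_le.1 (h'.trans_eq cardinalMk_coe_sort)

theorem rank_lt_of_mem_H (hx : x ∈ H θ) : rank x < θ.ord :=
  Cardinal.lt_ord.2 ((card_rank_le x).trans_lt hx)

instance small_H : Small.{u} (H θ) := by
  have h : H θ ⊆ (vonNeumann θ.ord : Set ZFSet.{u}) := fun x hx =>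
    -- The rank of `x` has at most as many predecessors as the transitive closure of `x` has
    -- elements, so it lies below the initial ordinal of `θ`.
    mem_vonNeumann.2 (rank_lt_of_mem_H hx)
  have : Small.{u} (vonNeumann θ.ord : Set ZFSet.{u}) := small_coe _
  exact small_subset h

end ZFSet

namespace ZFSet

open Ordinal

/-! ### Ranks of codes -/

section Rank

variable {o : Ordinal.{u}} {x y : ZFSet.{u}}

theorem rank_orderedPair_lt (ho : Order.IsSuccLimit o) (hx : rank x < o) (hy : rank y < o) :
    rank (pair x y) < o := by
  simp only [pair, rank_pair, rank_singleton, max_lt_iff]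
  exact ⟨ho.succ_lt (ho.succ_lt hx), ho.succ_lt (max_lt (ho.succ_lt hx) (ho.succ_lt hy))⟩

theorem rank_range_le {α : Type*} [Small.{u} α] {f : α → ZFSet.{u}} (h : ∀ i, rank (f i) < o) :
    rank (range f) ≤ o := by
  rw [rank_le_iff]
  intro y hy
  obtain ⟨i, rfl⟩ := mem_range.1 hy
  exact h i

theorem rank_natCode_lt (n : ℕ) : rank (natCode.{u} n) < ω := by
  induction n with
  | zero => simp [natCode, omega0_pos]
  | succ n ih =>
    rw [natCode, rank_insert]
    exact max_lt (isSuccLimit_omega0.succ_lt ih) ih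

theorem rank_ratCode_lt (q : ℚ) : rank (ratCode.{u} q) < ω :=
  rank_orderedPair_lt isSuccLimit_omega0 (rank_orderedPair_lt isSuccLimit_omega0
    (rank_natCode_lt _) (rank_natCode_lt _)) (rank_natCode_lt _)

theorem rank_realCode_le (a : ℝ) : rank (realCode.{u} a) ≤ ω :=
  rank_range_le fun _ => rank_ratCode_lt _

end Rank

/-! ### Natural numbers as sets -/

theorem mem_natCode {n : ℕ} {z : ZFSet.{u}} : z ∈ natCode n ↔ ∃ k < n, z = natCode k := by
  induction n with
  | zero => simp [natCode]
  | succ n ih =>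
    rw [natCode, mem_insert_iff, ih]
    constructor
    · rintro (rfl | ⟨k, hk, rfl⟩)
      · exact ⟨n, by omega, rfl⟩
      · exact ⟨k, by omega, rfl⟩
    · rintro ⟨k, hk, rfl⟩
      rcases Nat.lt_succ_iff_lt_or_eq.1 hk with hk | rfl
      · exact Or.inr ⟨k, hk, rfl⟩
      · exact Or.inl rfl

theorem natCode_mem_natCode_of_lt {m n : ℕ} (h : m < n) : natCode.{u} m ∈ natCode.{u} n :=
  mem_natCode.2 ⟨m, h, rfl⟩

theorem natCode_injective : Function.Injective natCode.{u} := by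
  intro m n h
  rcases lt_trichotomy m n with hlt | rfl | hlt
  · exact absurd (h ▸ natCode_mem_natCode_of_lt hlt) (mem_irrefl _)
  · rfl
  · exact absurd (h ▸ natCode_mem_natCode_of_lt hlt) (mem_irrefl _)

theorem natCode_inj {m n : ℕ} : natCode.{u} m = natCode.{u} n ↔ m = n :=
  natCode_injective.eq_iff

theorem ratCode_injective : Function.Injective ratCode.{u} := by
  intro q q' h
  simp only [ratCode, intCode, pair_inj, natCode_inj] at h
  exact Rat.ext (by omega) h.2

/-- The set of natural numbers. -/
noncomputable def omegaCode : ZFSet.{u} := range natCode.{u}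

theorem mem_omegaCode {z : ZFSet.{u}} : z ∈ omegaCode ↔ ∃ n, z = natCode n := by
  simp [omegaCode, eq_comm]

theorem rank_omegaCode_le : rank omegaCode.{u} ≤ ω :=
  rank_range_le rank_natCode_lt

theorem mem_realCode {a : ℝ} {q : ℚ} : ratCode.{u} q ∈ realCode a ↔ (q : ℝ) < a := by
  simp [realCode, ratCode_injective.eq_iff]

theorem realCode_subset {a b : ℝ} : realCode.{u} a ⊆ realCode b ↔ a ≤ b := by
  constructor
  · intro h
    by_contra! hlt
    obtain ⟨q, hq, hq'⟩ := exists_rat_btwn hlt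
    exact absurd (mem_realCode.1 (h (mem_realCode.2 hq'))) hq.not_gt
  · intro h z hz
    obtain ⟨q, rfl⟩ := mem_range.1 hz
    exact mem_realCode.2 (q.2.trans_le h)

theorem realCode_injective : Function.Injective realCode.{u} := fun _ _ h =>
  le_antisymm (realCode_subset.1 h.le) (realCode_subset.1 h.ge)

end ZFSet

/-! ### Coding inside `H(θ)` -/

namespace HSet

open ZFSet Ordinal

variable {θ : Cardinal.{u}}

theorem ext_iff {a b : H θ} : a = b ↔ ∀ t : H θ, t.1 ∈ a.1 ↔ t.1 ∈ b.1 := by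
  refine ⟨fun h t => h ▸ Iff.rfl, fun h =>
    Subtype.ext (ZFSet.ext fun z => ⟨fun hz => ?_, fun hz => ?_⟩)⟩
  · exact (h ⟨z, mem_H_of_mem a.2 hz⟩).1 hz
  · exact (h ⟨z, mem_H_of_mem b.2 hz⟩).2 hz

variable [hθ : Fact ((vonNeumann (ω + ω : Ordinal.{u})).card < θ)]

theorem mem_of_rank_le_omega0 {x : ZFSet.{u}} (hx : rank x ≤ ω) : x ∈ H θ :=
  mem_H_of_rank_lt (hx.trans_lt (by simp)) hθ.out

include hθ in
theorem aleph0_le : Cardinal.aleph0 ≤ θ := by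
  exact ((Ordinal.aleph0_le_card.2 le_self_add).trans
    (card_le_card_vonNeumann (ω + ω))).trans hθ.out.le

/-- The ordered pair, as an operation on `H(θ)`. -/
def pair (a b : H θ) : H θ := ⟨ZFSet.pair a b, pair_mem_H aleph0_le a.2 b.2⟩

/-- The natural number `n` as an element of `H(θ)`. -/
noncomputable def nat (n : ℕ) : H θ := ⟨natCode n, mem_of_rank_le_omega0 (rank_natCode_lt n).le⟩

/-- The set of natural numbers as an element of `H(θ)`. -/
noncomputable def omega : H θ := ⟨omegaCode, mem_of_rank_le_omega0 rank_omegaCode_le⟩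

/-- The rational number `q` as an element of `H(θ)`. -/
noncomputable def rat (q : ℚ) : H θ := ⟨ratCode q, mem_of_rank_le_omega0 (rank_ratCode_lt q).le⟩

/-- The real number `a` as an element of `H(θ)`. -/
noncomputable def real (a : ℝ) : H θ := ⟨realCode a, mem_of_rank_le_omega0 (rank_realCode_le a)⟩

theorem pair_inj {a b c d : H θ} : pair a b = pair c d ↔ a = c ∧ b = d := by
  simp only [pair, ZFSet.pair_inj, Subtype.ext_iff]

theorem nat_inj {m n : ℕ} : (nat m : H θ) = nat n ↔ m = n := by
  simp only [nat, Subtype.mk.injEq, natCode_inj]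

theorem mem_nat {n : ℕ} {z : H θ} : z.1 ∈ (nat n : H θ).1 ↔ ∃ k < n, z = nat k := by
  simp only [nat, mem_natCode, Subtype.ext_iff]

theorem mem_omega {z : H θ} : z.1 ∈ (omega : H θ).1 ↔ ∃ n, z = nat n := by
  simp only [omega, nat, mem_omegaCode, Subtype.ext_iff]

theorem nat_mem_omega (n : ℕ) : (nat n : H θ).1 ∈ (omega : H θ).1 :=
  mem_omega.2 ⟨n, rfl⟩

theorem rat_eq (q : ℚ) : (rat q : H θ) =
    pair (pair (nat q.num.toNat) (nat (-q.num).toNat)) (nat q.den) := rfl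

theorem rat_mem_real {q : ℚ} {a : ℝ} : (rat q : H θ).1 ∈ (real a : H θ).1 ↔ (q : ℝ) < a :=
  mem_realCode

theorem mem_real {z : H θ} {a : ℝ} :
    z.1 ∈ (real a : H θ).1 ↔ ∃ q : ℚ, (q : ℝ) < a ∧ z = rat q := by
  simp [real, realCode, rat, Subtype.ext_iff, eq_comm]

theorem real_injective : Function.Injective (real : ℝ → H θ) := fun _ _ h =>
  realCode_injective (congrArg Subtype.val h)

/-! ### Rationals and reals described by first-order formulas -/

/-- A set codes an injection of `a × b` into `c × d`. -/
def MulLE (a b c d : H θ) : Prop :=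
  ∃ g : H θ, (∀ i : H θ, i.1 ∈ a.1 → ∀ j : H θ, j.1 ∈ b.1 → ∃ k : H θ, k.1 ∈ c.1 ∧
    ∃ l : H θ, l.1 ∈ d.1 ∧ (pair (pair i j) (pair k l)).1 ∈ g.1) ∧
    ∀ i j i' j' k l : H θ, (pair (pair i j) (pair k l)).1 ∈ g.1 →
      (pair (pair i' j') (pair k l)).1 ∈ g.1 → i = i' ∧ j = j'

/-- Multiplication of naturals is expressed without recursion, by comparing cardinalities of finite
products. The graph of an injection between such products has rank at most `ω`, so it is available
in `H(θ)`. -/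
theorem mulLE_nat {a b c d : ℕ} :
    MulLE (nat a : H θ) (nat b) (nat c) (nat d) ↔ a * b ≤ c * d := by
  constructor
  · rintro ⟨g, hg, hinj⟩
    have h : ∀ x : Fin a × Fin b, ∃ y : Fin c × Fin d,
        (pair (pair (nat x.1) (nat x.2)) (pair (nat y.1) (nat y.2)) : H θ).1 ∈ g.1 := by
      rintro ⟨i, j⟩
      obtain ⟨k, hk, l, hl, h⟩ := hg (nat i) (mem_nat.2 ⟨i, i.2, rfl⟩) (nat j)
        (mem_nat.2 ⟨j, j.2, rfl⟩)
      obtain ⟨k, hk', rfl⟩ := mem_nat.1 hk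
      obtain ⟨l, hl', rfl⟩ := mem_nat.1 hl
      exact ⟨(⟨k, hk'⟩, ⟨l, hl'⟩), h⟩
    choose F hF using h
    have hFi : Function.Injective F := by
      intro x y hxy
      have := hinj _ _ _ _ _ _ (hF x) (hxy ▸ hF y)
      exact Prod.ext (Fin.ext (nat_inj.1 this.1)) (Fin.ext (nat_inj.1 this.2))
    simpa using Fintype.card_le_of_injective F hFi
  · intro h
    obtain ⟨F⟩ : Nonempty (Fin a × Fin b ↪ Fin c × Fin d) :=
      Function.Embedding.nonempty_of_card_le (by simpa using h)
    have hr : rank (range fun x : Fin a × Fin b => (pair (pair (nat x.1) (nat x.2))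
        (pair (nat (F x).1) (nat (F x).2)) : H θ).1) ≤ ω :=
      rank_range_le fun x => rank_orderedPair_lt isSuccLimit_omega0
        (rank_orderedPair_lt isSuccLimit_omega0 (rank_natCode_lt _) (rank_natCode_lt _))
        (rank_orderedPair_lt isSuccLimit_omega0 (rank_natCode_lt _) (rank_natCode_lt _))
    refine ⟨⟨_, mem_of_rank_le_omega0 hr⟩, fun i hi j hj => ?_, fun i j i' j' k l h h' => ?_⟩
    · obtain ⟨i, hi', rfl⟩ := mem_nat.1 hi
      obtain ⟨j, hj', rfl⟩ := mem_nat.1 hj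
      refine ⟨nat (F (⟨i, hi'⟩, ⟨j, hj'⟩)).1, mem_nat.2 ⟨_, Fin.is_lt _, rfl⟩,
        nat (F (⟨i, hi'⟩, ⟨j, hj'⟩)).2, mem_nat.2 ⟨_, Fin.is_lt _, rfl⟩, ?_⟩
      exact mem_range.2 ⟨(⟨i, hi'⟩, ⟨j, hj'⟩), rfl⟩
    · simp only [mem_range, ← Subtype.ext_iff, pair_inj] at h h'
      obtain ⟨x, ⟨rfl, rfl⟩, hk, hl⟩ := h
      obtain ⟨y, ⟨rfl, rfl⟩, hk', hl'⟩ := h'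
      have hxy : x = y := F.injective <| Prod.ext
        (Fin.ext (nat_inj.1 (hk.trans hk'.symm))) (Fin.ext (nat_inj.1 (hl.trans hl'.symm)))
      subst hxy
      exact ⟨rfl, rfl⟩

/-- `z` is a rational number, in lowest terms. -/
def IsRat (z : H θ) : Prop :=
  ∃ p n d : H θ, (p.1 ∈ (omega : H θ).1 ∧ n.1 ∈ (omega : H θ).1 ∧ d.1 ∈ (omega : H θ).1) ∧
    z = pair (pair p n) d ∧ (p = nat 0 ∨ n = nat 0) ∧ ¬ d = nat 0 ∧
    ∀ d' p' n' : H θ, d'.1 ∈ d.1 → p'.1 ∈ (omega : H θ).1 → n'.1 ∈ (omega : H θ).1 →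
      (MulLE p d' p' d ∧ MulLE p' d p d') → (MulLE n d' n' d ∧ MulLE n' d n d') → d' = nat 0

/-- Lowest terms mean that no equal fraction has a smaller nonzero denominator. The value `d' = 0`
must be allowed, since `p' = n' = d' = 0` always satisfies both equations. -/
theorem isRat_iff {z : H θ} : IsRat z ↔ ∃ q : ℚ, z = rat q := by
  constructor
  · rintro ⟨p, n, d, ⟨hp, hn, hd⟩, rfl, h0, hd0, hred⟩
    obtain ⟨p, rfl⟩ := mem_omega.1 hp
    obtain ⟨n, rfl⟩ := mem_omega.1 hn
    obtain ⟨d, rfl⟩ := mem_omega.1 hd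
    simp only [nat_inj] at h0 hd0
    have hred' : ∀ d' p' n' : ℕ, d' < d → p * d' = p' * d → n * d' = n' * d → d' = 0 := by
      intro d' p' n' hd' h h'
      refine nat_inj.1 (hred (nat d') (nat p') (nat n') (mem_nat.2 ⟨d', hd', rfl⟩)
        (nat_mem_omega _) (nat_mem_omega _) ?_ ?_)
      · exact ⟨mulLE_nat.2 h.le, mulLE_nat.2 h.ge⟩
      · exact ⟨mulLE_nat.2 h'.le, mulLE_nat.2 h'.ge⟩
    have hcop : Nat.Coprime ((p : ℤ) - n).natAbs d := by
      have hpn : ((p : ℤ) - n).natAbs = p + n := by omega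
      rw [hpn]
      have hgpos : 0 < Nat.gcd (p + n) d := Nat.gcd_pos_of_pos_right _ (Nat.pos_of_ne_zero hd0)
      have hgp : Nat.gcd (p + n) d ∣ p ∧ Nat.gcd (p + n) d ∣ n := by
        have := Nat.gcd_dvd_left (p + n) d
        rcases h0 with rfl | rfl <;> simpa using this
      have hgd := Nat.gcd_dvd_right (p + n) d
      unfold Nat.Coprime
      -- Dividing `p`, `n` and `d` by a common factor `g ≥ 2` would give an equal fraction with a
      -- smaller nonzero denominator, against `hred'`.
      generalize Nat.gcd (p + n) d = g at *
      obtain ⟨⟨p', rfl⟩, ⟨n', rfl⟩⟩ := hgp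
      obtain ⟨d', rfl⟩ := hgd
      by_contra hg1
      have hd' : d' ≠ 0 := by rintro rfl; simp at hd0
      exact hd' (hred' d' p' n' (by nlinarith [Nat.pos_of_ne_zero hd', show 2 ≤ g by omega])
        (by ring) (by ring))
    refine ⟨⟨(p : ℤ) - n, d, hd0, hcop⟩, ?_⟩
    have h1 : ((p : ℤ) - n).toNat = p := by omega
    have h2 : (-((p : ℤ) - n)).toNat = n := by omega
    rw [rat_eq, h1, h2]
  · rintro ⟨q, rfl⟩
    refine ⟨_, _, _, ⟨nat_mem_omega _, nat_mem_omega _, nat_mem_omega _⟩, rat_eq q, ?_, ?_, ?_⟩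
    · simp only [nat_inj]
      omega
    · simpa only [nat_inj] using q.den_nz
    · intro d' p' n' hd' hp' hn' h h'
      obtain ⟨p', rfl⟩ := mem_omega.1 hp'
      obtain ⟨n', rfl⟩ := mem_omega.1 hn'
      obtain ⟨d', hlt, rfl⟩ := mem_nat.1 hd'
      simp only [mulLE_nat] at h h'
      have heq : q.num.natAbs * d' = (p' + n') * q.den := by
        have : q.num.natAbs = q.num.toNat + (-q.num).toNat := by omega
        rw [this, add_mul, add_mul]
        omega
      have hdvd : q.den ∣ d' := q.reduced.symm.dvd_of_dvd_mul_left ⟨p' + n', by rw [heq, mul_comm]⟩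
      rw [nat_inj]
      exact Nat.eq_zero_of_dvd_of_lt hdvd hlt

/-- `z` and `z'` code fractions, the first of which is smaller. -/
def RatLT (z z' : H θ) : Prop :=
  ∃ p n d p' n' d' : H θ, z = pair (pair p n) d ∧ z' = pair (pair p' n') d' ∧
    (¬ MulLE p' d p d' ∨ ¬ MulLE n d' n' d)

/-- The positive and negative parts of a numerator are never both nonzero. Cross-multiplying the
positive parts detects the order of nonnegative rationals, cross-multiplying the negative parts that
of nonpositive ones, and opposite signs are covered by either alternative. -/
theorem ratLT_rat {q q' : ℚ} : RatLT (rat q : H θ) (rat q') ↔ q < q' := by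
  have key : RatLT (rat q : H θ) (rat q') ↔
      q.num.toNat * q'.den < q'.num.toNat * q.den ∨
        (-q'.num).toNat * q.den < (-q.num).toNat * q'.den := by
    constructor
    · rintro ⟨p, n, d, p', n', d', h, h', hlt⟩
      simp only [rat_eq, pair_inj] at h h'
      obtain ⟨⟨rfl, rfl⟩, rfl⟩ := h
      obtain ⟨⟨rfl, rfl⟩, rfl⟩ := h'
      simpa only [mulLE_nat, not_le] using hlt
    · intro h
      refine ⟨_, _, _, _, _, _, rat_eq q, rat_eq q', ?_⟩
      simpa only [mulLE_nat, not_le] using h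
  rw [key, Rat.lt_iff]
  have hd : (0 : ℤ) < q.den := by exact_mod_cast q.den_pos
  have hd' : (0 : ℤ) < q'.den := by exact_mod_cast q'.den_pos
  zify
  rw [Int.toNat_eq_max, Int.toNat_eq_max, Int.toNat_eq_max, Int.toNat_eq_max]
  generalize q.num = a, q'.num = b, (q.den : ℤ) = c, (q'.den : ℤ) = d at *
  rcases le_total 0 a with ha | ha <;> rcases le_total 0 b with hb | hb
  · rw [max_eq_left ha, max_eq_left hb, max_eq_right (by omega), max_eq_right (by omega)]
    simp
  · rw [max_eq_left ha, max_eq_right hb, max_eq_left (by omega : (0 : ℤ) ≤ -b),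
      max_eq_right (by omega)]
    constructor
    · rintro (h | h) <;> nlinarith
    · intro h; nlinarith
  · rw [max_eq_right ha, max_eq_left hb, max_eq_right (by omega), max_eq_left (by omega)]
    constructor
    · rintro (h | h) <;> nlinarith
    · intro h
      by_contra! h'
      nlinarith
  · rw [max_eq_right ha, max_eq_right hb, max_eq_left (by omega : (0 : ℤ) ≤ -b),
      max_eq_left (by omega : (0 : ℤ) ≤ -a)]
    simp

/-- `c` is a Dedekind cut. -/
def IsReal (c : H θ) : Prop :=
  (∀ z : H θ, z.1 ∈ c.1 → IsRat z) ∧ (∃ z : H θ, z.1 ∈ c.1) ∧ (∃ z : H θ, IsRat z ∧ ¬ z.1 ∈ c.1) ∧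
    (∀ z : H θ, z.1 ∈ c.1 → ∀ z' : H θ, IsRat z' → RatLT z' z → z'.1 ∈ c.1) ∧
    ∀ z : H θ, z.1 ∈ c.1 → ∃ z' : H θ, z'.1 ∈ c.1 ∧ RatLT z z'

theorem isReal_iff {c : H θ} : IsReal c ↔ ∃ a : ℝ, c = real a := by
  constructor
  · rintro ⟨hrat, ⟨z₀, hz₀⟩, ⟨z₁, hz₁, hz₁c⟩, hdown, hmax⟩
    obtain ⟨q₀, rfl⟩ := isRat_iff.1 (hrat z₀ hz₀)
    obtain ⟨q₁, rfl⟩ := isRat_iff.1 hz₁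
    have hdown' : ∀ q q' : ℚ, (rat q : H θ).1 ∈ c.1 → q' ≤ q → (rat q' : H θ).1 ∈ c.1 := by
      intro q q' hq hqq'
      rcases hqq'.eq_or_lt with rfl | hlt
      · exact hq
      · exact hdown _ hq _ (isRat_iff.2 ⟨q', rfl⟩) (ratLT_rat.2 hlt)
    set S : Set ℝ := (fun q : ℚ => (q : ℝ)) '' {q : ℚ | (rat q : H θ).1 ∈ c.1} with hS
    have hbdd : BddAbove S := by
      refine ⟨q₁, ?_⟩
      rintro _ ⟨q, hq, rfl⟩
      by_contra! hlt
      exact hz₁c (hdown' q q₁ hq (by exact_mod_cast hlt.le))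
    have hne : S.Nonempty := ⟨q₀, q₀, hz₀, rfl⟩
    refine ⟨sSup S, ext_iff.2 fun t => ?_⟩
    rw [mem_real]
    constructor
    · intro ht
      obtain ⟨q, rfl⟩ := isRat_iff.1 (hrat t ht)
      obtain ⟨z', hz', hlt⟩ := hmax _ ht
      obtain ⟨q', rfl⟩ := isRat_iff.1 (hrat z' hz')
      have hlt' : (q : ℝ) < q' := by exact_mod_cast ratLT_rat.1 hlt
      exact ⟨q, hlt'.trans_le (le_csSup hbdd ⟨q', hz', rfl⟩), rfl⟩
    · rintro ⟨q, hq, rfl⟩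
      obtain ⟨_, ⟨q', hq', rfl⟩, hlt⟩ := exists_lt_of_lt_csSup hne hq
      exact hdown' q' q hq' (Rat.cast_le.1 hlt.le)
  · rintro ⟨a, rfl⟩
    refine ⟨fun z hz => ?_, ?_, ?_, fun z hz z' hz' hlt => ?_, fun z hz => ?_⟩
    · obtain ⟨q, -, rfl⟩ := mem_real.1 hz
      exact isRat_iff.2 ⟨q, rfl⟩
    · obtain ⟨q, hq⟩ := exists_rat_lt a
      exact ⟨rat q, rat_mem_real.2 hq⟩
    · obtain ⟨q, hq⟩ := exists_rat_gt a
      exact ⟨rat q, isRat_iff.2 ⟨q, rfl⟩, fun h => hq.not_gt (rat_mem_real.1 h)⟩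
    · obtain ⟨q, hq, rfl⟩ := mem_real.1 hz
      obtain ⟨q', rfl⟩ := isRat_iff.1 hz'
      have : (q' : ℝ) < q := by exact_mod_cast ratLT_rat.1 hlt
      exact rat_mem_real.2 (this.trans hq)
    · obtain ⟨q, hq, rfl⟩ := mem_real.1 hz
      obtain ⟨q', hqq', hq'⟩ := exists_rat_btwn hq
      exact ⟨rat q', rat_mem_real.2 hq', ratLT_rat.2 (by exact_mod_cast hqq')⟩

end HSet

namespace HSet

open ZFSet Ordinal

/-! ### Continuous functions as sets -/

section ContinuousFunctions

variable {θ : Cardinal.{u}} [hθ : Fact ((vonNeumann (ω + ω : Ordinal.{u})).card < θ)]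

/-- `a` is a proper subset of `b`. -/
def SSub (a b : H θ) : Prop := ¬ a = b ∧ ∀ z : H θ, z.1 ∈ a.1 → z.1 ∈ b.1

theorem sSub_real {a b : ℝ} : SSub (real a : H θ) (real b) ↔ a < b := by
  have h : (∀ z : H θ, z.1 ∈ (real a : H θ).1 → z.1 ∈ (real b : H θ).1) ↔ a ≤ b := by
    rw [← realCode_subset.{u}]
    exact ⟨fun h z hz => h ⟨z, mem_H_of_mem (real a : H θ).2 hz⟩ hz, fun h _ hz => h hz⟩
  rw [SSub, h, real_injective.eq_iff, lt_iff_le_and_ne, and_comm]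

/-- `f` is a continuous real function on the space with underlying set `X` and topology `T`. -/
def IsCont (X T f : H θ) : Prop :=
  (∀ p : H θ, p.1 ∈ f.1 → ∃ x : H θ, x.1 ∈ X.1 ∧ ∃ c : H θ, IsReal c ∧ p = pair x c) ∧
  (∀ x : H θ, x.1 ∈ X.1 → ∃ c : H θ, (pair x c).1 ∈ f.1) ∧
  (∀ x c c' : H θ, (pair x c).1 ∈ f.1 → (pair x c').1 ∈ f.1 → c = c') ∧
  ∀ a : H θ, IsReal a →
    (∃ U : H θ, U.1 ∈ T.1 ∧ ∀ x : H θ, x.1 ∈ X.1 →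
      (x.1 ∈ U.1 ↔ ∃ c : H θ, (pair x c).1 ∈ f.1 ∧ SSub c a)) ∧
    ∃ U : H θ, U.1 ∈ T.1 ∧ ∀ x : H θ, x.1 ∈ X.1 →
      (x.1 ∈ U.1 ↔ ∃ c : H θ, (pair x c).1 ∈ f.1 ∧ SSub a c)

variable {K : Type u} {e : K ↪ ZFSet.{u}}

omit hθ in
theorem mem_subsetCode {A : Set K} {z : ZFSet.{u}} : z ∈ subsetCode e A ↔ ∃ x ∈ A, z = e x := by
  simp [subsetCode, eq_comm]

theorem apply_mem_subsetCode {A : Set K} {x : K} : e x ∈ subsetCode e A ↔ x ∈ A := by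
  simp [mem_subsetCode]

theorem pair_mem_funCode {F : K → ℝ} {x c : H θ} :
    (pair x c).1 ∈ funCode e F ↔ ∃ y, x.1 = e y ∧ c = real (F y) := by
  simp only [funCode, mem_range, pair, ZFSet.pair_inj, Subtype.ext_iff, real]
  exact exists_congr fun y => by rw [eq_comm, @eq_comm _ c.1]

theorem funCode_injective : Function.Injective (funCode e : (K → ℝ) → ZFSet.{u}) := by
  intro F G h
  funext x
  have : ZFSet.pair (e x) (realCode (F x)) ∈ funCode e G := h ▸ mem_range_self x
  obtain ⟨y, hy⟩ := mem_range.1 this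
  obtain ⟨h1, h2⟩ := ZFSet.pair_inj.1 hy
  rw [← realCode_injective h2, e.injective h1]

variable [TopologicalSpace K]

/-- Continuity seen from inside `H(θ)` is genuine continuity: every real and every open set
concerned belongs to `H(θ)`. Preimages of open rays are enough, since they express lower and upper
semicontinuity, so open subsets of the line need no codes. -/
theorem isCont_iff {X T f : H θ} (hX : X.1 = subsetCode e Set.univ)
    (hT : T.1 = range fun U : TopologicalSpace.Opens K => subsetCode e U) :
    IsCont X T f ↔ ∃ F : C(K, ℝ), f.1 = funCode e F := by
  have hmX : ∀ x : H θ, x.1 ∈ X.1 ↔ ∃ y, x.1 = e y := fun x => by simp [hX, mem_subsetCode]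
  have hpt : ∀ y, e y ∈ H θ := fun y =>
    mem_H_of_mem X.2 (hX ▸ apply_mem_subsetCode.2 (Set.mem_univ y))
  constructor
  · rintro ⟨h1, h2, h3, h4⟩
    have hex : ∀ y, ∃ a : ℝ, (pair ⟨e y, hpt y⟩ (real a)).1 ∈ f.1 := by
      intro y
      obtain ⟨c, hc⟩ := h2 ⟨e y, hpt y⟩ ((hmX _).2 ⟨y, rfl⟩)
      obtain ⟨x, -, c', hc', hp⟩ := h1 _ hc
      obtain ⟨a, rfl⟩ := isReal_iff.1 hc'
      rw [(pair_inj.1 hp).2] at hc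
      exact ⟨a, hc⟩
    choose F hF using hex
    have hval : ∀ y (c : H θ), (pair ⟨e y, hpt y⟩ c).1 ∈ f.1 ↔ c = real (F y) := fun y c =>
      ⟨fun h => h3 _ _ _ h (hF y), fun h => h ▸ hF y⟩
    have hopen : ∀ s : Set ℝ, (∃ a : ℝ, s = Set.Iio a) ∨ (∃ a : ℝ, s = Set.Ioi a) →
        IsOpen (F ⁻¹' s) := by
      have aux : ∀ (s : Set ℝ) (U : H θ), U.1 ∈ T.1 →
          (∀ y, e y ∈ U.1 ↔ F y ∈ s) → IsOpen (F ⁻¹' s) := by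
        intro s U hU h
        rw [hT] at hU
        obtain ⟨O, hO⟩ := mem_range.1 hU
        have : F ⁻¹' s = O := by
          ext y
          rw [Set.mem_preimage, ← h y, ← hO]
          exact apply_mem_subsetCode
        exact this ▸ O.isOpen
      rintro _ (⟨a, rfl⟩ | ⟨a, rfl⟩)
      · obtain ⟨U, hU, h⟩ := (h4 (real a) (isReal_iff.2 ⟨a, rfl⟩)).1
        refine aux _ U hU fun y => (h ⟨e y, hpt y⟩ ((hmX _).2 ⟨y, rfl⟩)).trans ?_
        simp only [hval, exists_eq_left, sSub_real, Set.mem_Iio]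
      · obtain ⟨U, hU, h⟩ := (h4 (real a) (isReal_iff.2 ⟨a, rfl⟩)).2
        refine aux _ U hU fun y => (h ⟨e y, hpt y⟩ ((hmX _).2 ⟨y, rfl⟩)).trans ?_
        simp only [hval, exists_eq_left, sSub_real, Set.mem_Ioi]
    have hcont : Continuous F := by
      refine continuous_iff_lower_upperSemicontinuous.2
        ⟨lowerSemicontinuous_iff_isOpen_preimage.2 fun a => hopen _ (Or.inr ⟨a, rfl⟩),
          upperSemicontinuous_iff_isOpen_preimage.2 fun a => hopen _ (Or.inl ⟨a, rfl⟩)⟩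
    refine ⟨⟨F, hcont⟩, ZFSet.ext fun p => ⟨fun hp => ?_, fun hp => ?_⟩⟩
    · obtain ⟨x, hx, c, -, hpxc⟩ := h1 ⟨p, mem_H_of_mem f.2 hp⟩ hp
      obtain ⟨y, hy⟩ := (hmX x).1 hx
      obtain rfl : x = ⟨e y, hpt y⟩ := Subtype.ext hy
      have hp' : p = (pair ⟨e y, hpt y⟩ c).1 := congrArg Subtype.val hpxc
      rw [hp'] at hp ⊢
      exact pair_mem_funCode.2 ⟨y, rfl, (hval y c).1 hp⟩
    · obtain ⟨y, rfl⟩ := mem_range.1 hp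
      exact hF y
  · rintro ⟨F, hF⟩
    have hmf : ∀ x c : H θ, (pair x c).1 ∈ f.1 ↔ ∃ y, x.1 = e y ∧ c = real (F y) := fun x c => by
      rw [hF, pair_mem_funCode]
    have hval : ∀ y (c : H θ), (pair ⟨e y, hpt y⟩ c).1 ∈ f.1 ↔ c = real (F y) := fun y c => by
      simp [hmf]
    have hopen : ∀ (s : Set ℝ) (R : H θ → Prop), IsOpen s → (∀ b, R (real b) ↔ b ∈ s) →
        ∃ U : H θ, U.1 ∈ T.1 ∧ ∀ x : H θ, x.1 ∈ X.1 →
          (x.1 ∈ U.1 ↔ ∃ c : H θ, (pair x c).1 ∈ f.1 ∧ R c) := by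
      intro s R hs hR
      have hU : subsetCode e (F ⁻¹' s) ∈ T.1 :=
        hT ▸ mem_range.2 ⟨⟨F ⁻¹' s, hs.preimage F.continuous⟩, rfl⟩
      refine ⟨⟨_, mem_H_of_mem T.2 hU⟩, hU, fun x hx => ?_⟩
      obtain ⟨y, hy⟩ := (hmX x).1 hx
      obtain rfl : x = ⟨e y, hpt y⟩ := Subtype.ext hy
      simp only [hval, exists_eq_left, hR, apply_mem_subsetCode, Set.mem_preimage]
    refine ⟨fun p hp => ?_, fun x hx => ?_, fun x c c' h h' => ?_, fun a ha => ?_⟩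
    · have hp' := hp
      rw [hF] at hp'
      obtain ⟨y, hy⟩ := mem_range.1 hp'
      exact ⟨⟨e y, hpt y⟩, (hmX _).2 ⟨y, rfl⟩, real (F y), isReal_iff.2 ⟨_, rfl⟩,
        Subtype.ext hy.symm⟩
    · obtain ⟨y, hy⟩ := (hmX x).1 hx
      exact ⟨real (F y), (hmf _ _).2 ⟨y, hy, rfl⟩⟩
    · obtain ⟨y, hy, rfl⟩ := (hmf _ _).1 h
      obtain ⟨y', hy', rfl⟩ := (hmf _ _).1 h'
      rw [e.injective (hy.symm.trans hy')]
    · obtain ⟨a, rfl⟩ := isReal_iff.1 ha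
      exact ⟨hopen (Set.Iio a) (fun c => SSub c (real a)) isOpen_Iio fun b => sSub_real,
        hopen (Set.Ioi a) (fun c => SSub (real a) c) isOpen_Ioi fun b => sSub_real⟩

end ContinuousFunctions

/-! ### Definability of the codes -/

section Definability

variable {θ : Cardinal.{u}} {M : setTheoryLanguage.ElementarySubstructure (ZFSet.H θ)}
  {V : Type*} [hθ : Fact ((vonNeumann (ω + ω : Ordinal.{u})).card < θ)]

theorem definableTerm_pair {a b : (V → H θ) → H θ} (ha : DefinableTerm M a)
    (hb : DefinableTerm M b) : DefinableTerm M fun w => pair (a w) (b w) := by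
  have h : DefinablePred M fun w : Fin 3 → H θ => w 0 = pair (w 1) (w 2) := by
    refine DefinablePred.congr (P := fun w => ∀ t : H θ, t.1 ∈ (w 0).1 ↔
      (∀ s : H θ, s.1 ∈ t.1 ↔ s = w 1) ∨ (∀ s : H θ, s.1 ∈ t.1 ↔ s = w 1 ∨ s = w 2)) ?_ fun w => ?_
    · exact .all (.iff (.mem_var _ _) (.or (.all (.iff (.mem_var _ _) (.eq_var _ _)))
        (.all (.iff (.mem_var _ _) (.or (.eq_var _ _) (.eq_var _ _))))))
    -- The singleton and the doubleton forming the pair are themselves in `H(θ)`, so quantifying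
    -- over `H(θ)` only misses nothing.
    · have hs : ({(w 1).1} : ZFSet) ∈ H θ :=
        mem_H_of_mem (pair (w 1) (w 2)).2 (by simp [pair, ZFSet.pair])
      have hd : ({(w 1).1, (w 2).1} : ZFSet) ∈ H θ :=
        mem_H_of_mem (pair (w 1) (w 2)).2 (by simp [pair, ZFSet.pair])
      have h1 : ∀ t : H θ, t = ⟨_, hs⟩ ↔ ∀ s : H θ, s.1 ∈ t.1 ↔ s = w 1 := fun t => by
        rw [ext_iff]; simp [Subtype.ext_iff]
      have h2 : ∀ t : H θ, t = ⟨_, hd⟩ ↔ ∀ s : H θ, s.1 ∈ t.1 ↔ s = w 1 ∨ s = w 2 := fun t => by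
        rw [ext_iff]; simp [Subtype.ext_iff]
      rw [ext_iff]
      refine forall_congr' fun t => ?_
      rw [← h1, ← h2]
      simp [pair, ZFSet.pair, Subtype.ext_iff]
  exact h.subst₃ (R := fun x y z => x = pair y z) (a := fun w => w none)
    (b := fun w => a fun v => w (some v))
    (c := fun w => b fun v => w (some v)) (.var _) (ha.relabel (Option.map some))
    (hb.relabel (Option.map some))

theorem pair_mem {a b : H θ} (ha : a ∈ M) (hb : b ∈ M) : pair a b ∈ M :=
  DefinablePred.mem_of_unique (R := fun x => x = pair a b)
    (.eq (.var 0) (definableTerm_pair (.const ha) (.const hb))) rfl fun _ h => h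

theorem mem_of_pair_mem {a b : H θ} (h : pair a b ∈ M) : a ∈ M ∧ b ∈ M := by
  constructor
  · refine DefinablePred.mem_of_unique (R := fun x => ∃ y, pair x y = pair a b)
      (.ex (.eq (definableTerm_pair (.var _) (.var _)) (.const h))) ⟨b, rfl⟩ ?_
    rintro y ⟨z, hz⟩
    exact (pair_inj.1 hz).1
  · refine DefinablePred.mem_of_unique (R := fun x => ∃ y, pair y x = pair a b)
      (.ex (.eq (definableTerm_pair (.var _) (.var _)) (.const h))) ⟨a, rfl⟩ ?_
    rintro y ⟨z, hz⟩
    exact (pair_inj.1 hz).2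

theorem mem_nat_succ {n : ℕ} {t : H θ} :
    t.1 ∈ (nat (n + 1) : H θ).1 ↔ t.1 ∈ (nat n : H θ).1 ∨ t = nat n := by
  simp [nat, natCode, Subtype.ext_iff, or_comm]

theorem nat_mem (n : ℕ) : nat n ∈ M := by
  induction n with
  | zero =>
    refine DefinablePred.mem_of_unique (R := fun x => ∀ t : H θ, ¬ t.1 ∈ x.1)
      (.all (.not (.mem_var _ _))) (fun t => by simp [mem_nat]) fun y hy => ext_iff.2 fun t => ?_
    simp [hy t, mem_nat]
  | succ n ih =>
    refine DefinablePred.mem_of_unique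
      (R := fun x => ∀ t : H θ, t.1 ∈ x.1 ↔ t.1 ∈ (nat n : H θ).1 ∨ t = nat n)
      (.all (.iff (.mem_var _ _) (.or (.mem (.var _) (.const ih)) (.eq (.var _) (.const ih)))))
      (fun t => mem_nat_succ) fun y hy => ext_iff.2 fun t => ?_
    rw [hy, mem_nat_succ]

theorem rat_mem (q : ℚ) : rat q ∈ M :=
  pair_mem (pair_mem (nat_mem _) (nat_mem _)) (nat_mem _)

/-- The formula says: contains zero, closed under successor, and every nonzero element is the
successor of an element. Foundation makes the solution unique, so no minimality clause is needed. -/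
theorem omega_mem : omega ∈ M := by
  refine DefinablePred.mem_of_unique (R := fun x => (nat 0 : H θ).1 ∈ x.1 ∧
    (∀ n : H θ, n.1 ∈ x.1 → ∃ m : H θ, m.1 ∈ x.1 ∧ ∀ t : H θ, t.1 ∈ m.1 ↔ t.1 ∈ n.1 ∨ t = n) ∧
    ∀ n : H θ, n.1 ∈ x.1 → n = nat 0 ∨
      ∃ m : H θ, m.1 ∈ x.1 ∧ ∀ t : H θ, t.1 ∈ n.1 ↔ t.1 ∈ m.1 ∨ t = m) ?_ ?_ ?_
  · exact .and (.mem (.const (nat_mem 0)) (.var _)) <| .and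
      (.all (.imp (.mem_var _ _) (.ex (.and (.mem_var _ _)
        (.all (.iff (.mem_var _ _) (.or (.mem_var _ _) (.eq_var _ _)))))))) <|
      .all (.imp (.mem_var _ _) (.or (.eq_const _ (nat_mem 0)) (.ex (.and (.mem_var _ _)
        (.all (.iff (.mem_var _ _) (.or (.mem_var _ _) (.eq_var _ _))))))))
  · refine ⟨nat_mem_omega 0, fun n hn => ?_, fun n hn => ?_⟩
    · obtain ⟨n, rfl⟩ := mem_omega.1 hn
      exact ⟨nat (n + 1), nat_mem_omega _, fun t => mem_nat_succ⟩
    · obtain ⟨n, rfl⟩ := mem_omega.1 hn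
      cases n with
      | zero => exact Or.inl rfl
      | succ n => exact Or.inr ⟨nat n, nat_mem_omega _, fun t => mem_nat_succ⟩
  · rintro x ⟨h0, hs, hp⟩
    refine ext_iff.2 fun t => ⟨fun ht => ?_, fun ht => ?_⟩
    · obtain ⟨t, htH⟩ := t
      -- Membership induction works because a predecessor of `t` is an element of `t`.
      induction t using ZFSet.inductionOn with
      | _ t ih =>
        rcases hp _ ht with h | ⟨m, hm, h⟩
        · rw [h]
          exact nat_mem_omega 0
        · obtain ⟨k, hk⟩ := mem_omega.1 (ih m.1 ((h m).2 (Or.inr rfl)) m.2 hm)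
          refine mem_omega.2 ⟨k + 1, ext_iff.2 fun s => ?_⟩
          rw [h, mem_nat_succ, ← hk]
    · obtain ⟨n, rfl⟩ := mem_omega.1 ht
      induction n with
      | zero => exact h0
      | succ n ih =>
        obtain ⟨m, hm, h⟩ := hs _ (ih (nat_mem_omega n))
        have : m = nat (n + 1) := ext_iff.2 fun s => by rw [h, mem_nat_succ]
        exact this ▸ hm

variable {a b c d : (V → H θ) → H θ}

theorem definablePred_mulLE (ha : DefinableTerm M a) (hb : DefinableTerm M b)
    (hc : DefinableTerm M c) (hd : DefinableTerm M d) :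
    DefinablePred M fun w => MulLE (a w) (b w) (c w) (d w) := by
  refine DefinablePred.subst₄ ?_ ha hb hc hd
  unfold MulLE
  repeat' with_reducible first
    | exact .var _ | apply DefinablePred.and | apply DefinablePred.ex | apply DefinablePred.all
    | apply DefinablePred.imp | apply DefinablePred.mem | apply DefinablePred.eq
    | apply definableTerm_pair

theorem definablePred_isRat (ha : DefinableTerm M a) : DefinablePred M fun w => IsRat (a w) := by
  refine DefinablePred.subst₁ ?_ ha
  unfold IsRat
  repeat' with_reducible first
    | exact .var _ | exact .const omega_mem | exact .const (nat_mem 0)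
    | apply DefinablePred.and | apply DefinablePred.or | apply DefinablePred.not
    | apply DefinablePred.ex | apply DefinablePred.all
    | apply DefinablePred.imp | apply DefinablePred.mem | apply DefinablePred.eq
    | apply definableTerm_pair | apply definablePred_mulLE

theorem definablePred_ratLT (ha : DefinableTerm M a) (hb : DefinableTerm M b) :
    DefinablePred M fun w => RatLT (a w) (b w) := by
  refine DefinablePred.subst₂ ?_ ha hb
  unfold RatLT
  repeat' with_reducible first
    | exact .var _ | apply DefinablePred.and | apply DefinablePred.or | apply DefinablePred.not
    | apply DefinablePred.ex | apply DefinablePred.eq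
    | apply definableTerm_pair | apply definablePred_mulLE

theorem definablePred_isReal (ha : DefinableTerm M a) : DefinablePred M fun w => IsReal (a w) := by
  refine DefinablePred.subst₁ ?_ ha
  unfold IsReal
  repeat' with_reducible first
    | exact .var _ | apply DefinablePred.and | apply DefinablePred.not
    | apply DefinablePred.ex | apply DefinablePred.all
    | apply DefinablePred.imp | apply DefinablePred.mem
    | apply definablePred_isRat | apply definablePred_ratLT

theorem definablePred_isCont (ha : DefinableTerm M a) (hb : DefinableTerm M b)
    (hc : DefinableTerm M c) : DefinablePred M fun w => IsCont (a w) (b w) (c w) := by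
  refine DefinablePred.subst₃ ?_ ha hb hc
  unfold IsCont SSub
  repeat' with_reducible first
    | exact .var _ | apply DefinablePred.and | apply DefinablePred.not
    | apply DefinablePred.ex | apply DefinablePred.all | apply DefinablePred.iff
    | apply DefinablePred.imp | apply DefinablePred.mem | apply DefinablePred.eq
    | apply definableTerm_pair | apply definablePred_isReal

end Definability

end HSet

/-! ### Countable directed families in a retractional skeleton -/

namespace IsRetractionalSkeleton

variable {K : Type u} [TopologicalSpace K] {Γ : Type v} [PartialOrder Γ] {r : Γ → K → K}

theorem apply_of_mem_range (hr : IsRetractionalSkeleton r) {s t : Γ} (h : s ≤ t) {x : K}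
    (hx : x ∈ Set.range (r s)) : r t x = x := by
  obtain ⟨y, rfl⟩ := hx
  exact (congrFun (hr.compatible s t h).2 y).symm

/-- The skeleton axiom concerns strictly increasing sequences only. A monotone sequence is either
eventually constant, and then attains its bound, or has a strictly increasing cofinal subsequence;
its supremum inherits the agreement of `x` and `y` by passing to the limit. -/
theorem exists_upperBound_of_monotone [T2Space K] (hr : IsRetractionalSkeleton r) {s : ℕ → Γ}
    (hs : Monotone s) :
    ∃ t, (∀ n, s n ≤ t) ∧ ∀ x y, (∀ n, r (s n) x = r (s n) y) → r t x = r t y := by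
  by_cases hc : ∃ N, ∀ n ≥ N, s n = s N
  · obtain ⟨N, hN⟩ := hc
    refine ⟨s N, fun n => ?_, fun x y h => h N⟩
    rcases le_total n N with h | h
    · exact hs h
    · exact (hN n h).le
  · push Not at hc
    choose φ hφ hne using hc
    have hlt : ∀ N, s N < s (φ N) := fun N => lt_of_le_of_ne (hs (hφ N)) (hne N).symm
    have hstrict : StrictMono fun k => s (φ^[k] 0) := strictMono_nat_of_lt_succ fun k => by
      rw [Function.iterate_succ_apply']
      exact hlt _
    have hle : ∀ k, k ≤ φ^[k] 0 := fun k => by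
      induction k with
      | zero => exact Nat.zero_le _
      | succ k ih =>
        rw [Function.iterate_succ_apply']
        refine Nat.succ_le_of_lt (ih.trans_lt (lt_of_le_of_ne (hφ _) fun h => ?_))
        exact hne _ (congrArg s h.symm)
    obtain ⟨t, ht, hlim⟩ := hr.exists_sup _ hstrict
    refine ⟨t, fun n => (hs (hle n)).trans (ht.1 ⟨n, rfl⟩), fun x y h => ?_⟩
    exact tendsto_nhds_unique (hlim x) ((hlim y).congr fun n => (h _).symm)

theorem exists_upperBound_of_countable [T2Space K] (hr : IsRetractionalSkeleton r) {Y : Set Γ}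
    (hY : Y.Countable) (hne : Y.Nonempty) (hdir : DirectedOn (· ≤ ·) Y) :
    ∃ t, (∀ s ∈ Y, s ≤ t) ∧ ∀ x y, (∀ s ∈ Y, r s x = r s y) → r t x = r t y := by
  have := hY.toEncodable
  have : Inhabited Y := ⟨⟨hne.some, hne.some_mem⟩⟩
  have hd : Directed (· ≤ ·) (Subtype.val : Y → Γ) := directedOn_iff_directed.1 hdir
  obtain ⟨t, ht, h⟩ := hr.exists_upperBound_of_monotone hd.sequence_mono
  exact ⟨t, fun s hs => (hd.le_sequence ⟨s, hs⟩).trans (ht _),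
    fun x y hxy => h x y fun n => hxy _ (Subtype.coe_prop _)⟩

/-- For a suitable upper bound `t` of `Y`, the fixed points of `r t` form a closed set containing
all ranges indexed by `Y`, hence also `x` and `y`. -/
theorem eq_of_forall_apply_eq [T2Space K] (hr : IsRetractionalSkeleton r) {Y : Set Γ}
    (hY : Y.Countable) (hdir : DirectedOn (· ≤ ·) Y) {x y : K}
    (hx : x ∈ closure {d | ∃ s ∈ Y, d ∈ Set.range (r s)})
    (hy : y ∈ closure {d | ∃ s ∈ Y, d ∈ Set.range (r s)})
    (h : ∀ s ∈ Y, r s x = r s y) : x = y := by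
  have hne : Y.Nonempty := by
    obtain ⟨d, s, hs, -⟩ := closure_nonempty_iff.1 ⟨x, hx⟩
    exact ⟨s, hs⟩
  obtain ⟨t, ht, hsep⟩ := hr.exists_upperBound_of_countable hY hne hdir
  have hsub : closure {d | ∃ s ∈ Y, d ∈ Set.range (r s)} ⊆ {z | r t z = z} :=
    closure_minimal (fun d ⟨s, hs, hd⟩ => hr.apply_of_mem_range (ht s hs) hd)
      (isClosed_eq (hr.continuous t) continuous_id)
  calc x = r t x := (hsub hx).symm
    _ = r t y := hsep x y h
    _ = y := hsub hy

end IsRetractionalSkeleton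

/-! ### Countable separating families on metrizable retracts -/

/-- The range is compact metrizable, hence separable, and a point of it is determined by its
distances to a dense sequence. -/
theorem exists_continuousMap_separating {K : Type u} [TopologicalSpace K] [CompactSpace K]
    {r : K → K} (hr : Continuous r) (hm : TopologicalSpace.MetrizableSpace (Set.range r)) :
    ∃ F : ℕ → C(K, ℝ), ∀ x y, (∀ n, F n x = F n y) → r x = r y := by
  rcases isEmpty_or_nonempty K with hK | hK
  · exact ⟨fun _ => 0, fun x => isEmptyElim x⟩
  let _ := TopologicalSpace.metrizableSpaceMetric (Set.range r)
  have : CompactSpace (Set.range r) := isCompact_iff_compactSpace.1 (isCompact_range hr)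
  have hc : Continuous (Set.rangeFactorization r) := hr.subtype_mk _
  let d := TopologicalSpace.denseSeq (Set.range r)
  refine ⟨fun n => ⟨fun x => dist (Set.rangeFactorization r x) (d n), hc.dist continuous_const⟩,
    fun x y h => ?_⟩
  have hd : ∀ z, dist (Set.rangeFactorization r x) z = dist (Set.rangeFactorization r y) z :=
    fun z => congrFun ((TopologicalSpace.denseRange_denseSeq (Set.range r)).equalizer
      (continuous_const.dist continuous_id) (continuous_const.dist continuous_id)
      (funext fun n => h n)) z
  have := hd (Set.rangeFactorization r y)
  rw [dist_self, dist_eq_zero] at this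
  exact congrArg Subtype.val this

/-! ### Skeletons as elements of `H(θ)` -/

namespace HSet

open ZFSet Ordinal

section

variable {θ : Cardinal.{u}} [hθ : Fact ((vonNeumann (ω + ω : Ordinal.{u})).card < θ)]

/-- `Y` is a countable set, as seen from `H(θ)`. -/
def IsCountable (Y : H θ) : Prop :=
  ∃ g : H θ, ∀ s : H θ, s.1 ∈ Y.1 → ∃ n : H θ, n.1 ∈ (omega : H θ).1 ∧ (pair s n).1 ∈ g.1 ∧
    ∀ s' : H θ, (pair s' n).1 ∈ g.1 → s' = s

/-- `Y` is directed by the relation `L`. -/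
def IsDirected (L Y : H θ) : Prop :=
  ∀ a b : H θ, a.1 ∈ Y.1 → b.1 ∈ Y.1 →
    ∃ c : H θ, c.1 ∈ Y.1 ∧ (pair a c).1 ∈ L.1 ∧ (pair b c).1 ∈ L.1

/-- `x` is in the closure of the set of all `d ∈ D` which are `J`-related to an element of `Y`. -/
def InClosure (T D J Y x : H θ) : Prop :=
  ∀ U : H θ, U.1 ∈ T.1 → x.1 ∈ U.1 → ∃ d : H θ, d.1 ∈ D.1 ∧ d.1 ∈ U.1 ∧
    ∃ s : H θ, s.1 ∈ Y.1 ∧ (pair d s).1 ∈ J.1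

/-- A continuous function `W(n, s)` with `s ∈ Y` separates `x` and `y`. -/
def Separates (X T W Y x y : H θ) : Prop :=
  ∃ s n f : H θ, (s.1 ∈ Y.1 ∧ n.1 ∈ (omega : H θ).1) ∧ (pair (pair n s) f).1 ∈ W.1 ∧
    IsCont X T f ∧ ∃ c c' : H θ, (pair x c).1 ∈ f.1 ∧ (pair y c').1 ∈ f.1 ∧ ¬ c = c'

/-- The data `G, J, L, W` carry the properties of a retractional skeleton with index set `G`
that are needed to separate points: `J` relates the points of `D` to indices, `L` directs the
indices, and `W` assigns to each index a sequence of continuous functions. -/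
def IsSkeletonCode (X T D G J L W : H θ) : Prop :=
  (∀ d : H θ, d.1 ∈ D.1 → ∃ s : H θ, s.1 ∈ G.1 ∧ (pair d s).1 ∈ J.1) ∧
  IsDirected L G ∧
  (∀ p f f' : H θ, (pair p f).1 ∈ W.1 → (pair p f').1 ∈ W.1 → f = f') ∧
  (∃ Z : H θ, ∀ s n : H θ, s.1 ∈ G.1 → n.1 ∈ (omega : H θ).1 → (pair s n).1 ∈ Z.1) ∧
  ∀ Y : H θ, (∀ s : H θ, s.1 ∈ Y.1 → s.1 ∈ G.1) → IsCountable Y → IsDirected L Y →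
    ∀ x y : H θ, x.1 ∈ X.1 → y.1 ∈ X.1 → InClosure T D J Y x → InClosure T D J Y y → ¬ x = y →
      Separates X T W Y x y

variable {M : setTheoryLanguage.ElementarySubstructure (H θ)} {V : Type*}

theorem definablePred_isSkeletonCode {X T D : H θ} (hX : X ∈ M) (hT : T ∈ M) (hD : D ∈ M)
    {a b c d : (V → H θ) → H θ} (ha : DefinableTerm M a) (hb : DefinableTerm M b)
    (hc : DefinableTerm M c) (hd : DefinableTerm M d) :
    DefinablePred M fun w => IsSkeletonCode X T D (a w) (b w) (c w) (d w) := by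
  refine DefinablePred.subst₄ ?_ ha hb hc hd
  unfold IsSkeletonCode IsCountable IsDirected InClosure Separates
  repeat' with_reducible first
    | exact .var _ | exact .const omega_mem | exact .const hX | exact .const hT | exact .const hD
    | apply DefinablePred.and | apply DefinablePred.not
    | apply DefinablePred.ex | apply DefinablePred.all
    | apply DefinablePred.imp | apply DefinablePred.mem | apply DefinablePred.eq
    | apply definableTerm_pair | apply definablePred_isCont

variable {K : Type u} [TopologicalSpace K] {e : K ↪ ZFSet.{u}}

/-- The code lying in `M` need not come from the given skeleton; only the first-order properties of
`IsSkeletonCode` may be used. They are applied to `Y = G ∩ M`, which belongs to `H(θ)` as a subset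
of `G`, though not necessarily to `M`. -/
theorem injOn_of_isSkeletonCode {A : Set K} {X T D G J L W : H θ}
    (hX : X.1 = subsetCode e Set.univ)
    (hT : T.1 = range fun U : TopologicalSpace.Opens K => subsetCode e U)
    (hD : D.1 = subsetCode e A) (hG : G ∈ M) (hJ : J ∈ M) (hL : L ∈ M) (hW : W ∈ M)
    (hM : (modelSets M).Countable) (h : IsSkeletonCode X T D G J L W) :
    Set.InjOn (modelQuotientMap M e) (closure (modelPoints M e A)) := by
  obtain ⟨hJtot, hGdir, hWfun, ⟨Z, hZ⟩, hsep⟩ := h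
  intro x hx y hy hxy
  by_contra hne
  have hpt : ∀ y, e y ∈ H θ := fun y =>
    mem_H_of_mem X.2 (hX ▸ apply_mem_subsetCode.2 (Set.mem_univ y))
  let Y : H θ := ⟨ZFSet.sep (fun s => s ∈ modelSets M) G.1, mem_H_of_subset G.2 sep_subset⟩
  have hmY : ∀ s : H θ, s.1 ∈ Y.1 ↔ s.1 ∈ G.1 ∧ s ∈ M := fun s => by
    simp only [Y, mem_sep, modelSets, Set.mem_ofPred_eq]
    exact and_congr_right fun _ => ⟨fun ⟨_, h⟩ => h, fun h => ⟨s.2, h⟩⟩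
  have hYc : IsCountable Y := by
    obtain ⟨k, hk⟩ := Set.countable_iff_exists_injOn.1 hM
    let g : ZFSet.{u} :=
      -- The enumeration of `Y` is cut out of `Z`, which contains `G × ω`. Closure of `H(θ)` under
      -- subsets then suffices, and `θ` need not be regular.
      ZFSet.sep (fun z => ∃ s ∈ modelSets M, z = ZFSet.pair s (natCode (k s))) Z.1
    have hmg : ∀ z, z ∈ g ↔ z ∈ Z.1 ∧ ∃ s ∈ modelSets M, z = ZFSet.pair s (natCode (k s)) :=
      fun z => mem_sep
    refine ⟨⟨g, mem_H_of_subset Z.2 sep_subset⟩, fun s hs => ⟨nat (k s.1), nat_mem_omega _, ?_, ?_⟩⟩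
    · exact (hmg _).2 ⟨hZ _ _ ((hmY s).1 hs).1 (nat_mem_omega _), s.1, ⟨s.2, ((hmY s).1 hs).2⟩, rfl⟩
    · intro s' hs'
      obtain ⟨-, s₁, hs₁, heq⟩ := (hmg _).1 hs'
      obtain ⟨h1, h2⟩ := ZFSet.pair_inj.1 heq
      have := hk ⟨s.2, ((hmY s).1 hs).2⟩ hs₁ (natCode_injective h2)
      exact Subtype.ext (h1.trans this.symm)
  have hYd : IsDirected L Y := by
    intro a b ha hb
    obtain ⟨ha, haM⟩ := (hmY a).1 ha
    obtain ⟨hb, hbM⟩ := (hmY b).1 hb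
    -- Directedness passes from `G` to `G ∩ M`: an upper bound of two indices in `M` can be chosen
    -- in `M`.
    obtain ⟨c, hcM, hc, hac⟩ := DefinablePred.exists_mem (M := M)
      (R := fun c => c.1 ∈ G.1 ∧ (pair a c).1 ∈ L.1 ∧ (pair b c).1 ∈ L.1)
      (.and (.mem (.var _) (.const hG)) (.and
        (.mem (definableTerm_pair (.const haM) (.var _)) (.const hL))
        (.mem (definableTerm_pair (.const hbM) (.var _)) (.const hL)))) (hGdir a b ha hb)
    exact ⟨c, (hmY c).2 ⟨hc, hcM⟩, hac⟩
  have hcl : ∀ x ∈ closure (modelPoints M e A), InClosure T D J Y ⟨e x, hpt x⟩ := by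
    intro x hx U hU hxU
    rw [hT] at hU
    obtain ⟨O, hO⟩ := mem_range.1 hU
    rw [← hO] at hxU ⊢
    obtain ⟨d, hdO, hdA, hdH, hdM⟩ := mem_closure_iff.1 hx O O.isOpen
      (apply_mem_subsetCode.1 hxU)
    have hdD : e d ∈ D.1 := hD ▸ apply_mem_subsetCode.2 hdA
    obtain ⟨s, hsM, hs, hds⟩ := DefinablePred.exists_mem (M := M)
      (R := fun s => s.1 ∈ G.1 ∧ (pair ⟨e d, hdH⟩ s).1 ∈ J.1)
      (.and (.mem (.var _) (.const hG)) (.mem (definableTerm_pair (.const hdM) (.var _))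
        (.const hJ))) (hJtot ⟨e d, hdH⟩ hdD)
    exact ⟨⟨e d, hdH⟩, hdD, apply_mem_subsetCode.2 hdO, s, (hmY s).2 ⟨hs, hsM⟩, hds⟩
  have hmX : ∀ x, e x ∈ X.1 := fun x => hX ▸ apply_mem_subsetCode.2 (Set.mem_univ x)
  obtain ⟨s, n, f, ⟨hs, hn⟩, hf, hcont, c, c', hc, hc', hcc'⟩ :=
    hsep Y (fun s hs => ((hmY s).1 hs).1) hYc hYd ⟨e x, hpt x⟩ ⟨e y, hpt y⟩ (hmX x) (hmX y)
      (hcl x hx) (hcl y hy) fun h => hne (e.injective (congrArg Subtype.val h))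
  obtain ⟨n, rfl⟩ := mem_omega.1 hn
  -- `W` is functional, so `f` is definable from `n`, `s` and `W`.
  have hfM : f ∈ M := DefinablePred.mem_of_unique
    (R := fun f => (pair (pair (nat n) s) f).1 ∈ W.1)
    (.mem (definableTerm_pair (definableTerm_pair (.const (nat_mem n))
      (.const ((hmY s).1 hs).2)) (.var _)) (.const hW)) hf fun f' hf' => hWfun _ _ _ hf' hf
  obtain ⟨F, hF⟩ := (isCont_iff hX hT).1 hcont
  have hFxy : F x = F y := Quotient.exact hxy F ⟨hF ▸ f.2, by
    convert hfM
    exact hF.symm⟩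
  rw [hF] at hc hc'
  obtain ⟨x', hx', rfl⟩ := pair_mem_funCode.1 hc
  obtain ⟨y', hy', rfl⟩ := pair_mem_funCode.1 hc'
  rw [← e.injective hx', ← e.injective hy', hFxy] at hcc'
  exact hcc' rfl

end

theorem exists_isSkeletonCode {K : Type u} [TopologicalSpace K] [CompactSpace K] [T2Space K]
    (e : K ↪ ZFSet.{u}) {A : Set K} (hA : IsInducedByRetractionalSkeleton A) :
    ∃ θ₀ : Cardinal.{u}, ∀ θ : Cardinal.{u}, θ₀ ≤ θ →
      ∃ _ : Fact ((vonNeumann (ω + ω : Ordinal.{u})).card < θ),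
      ∀ X T D : H θ, X.1 = subsetCode e Set.univ →
        (T.1 = range fun U : TopologicalSpace.Opens K => subsetCode e U) →
        D.1 = subsetCode e A → ∃ G J L W : H θ, IsSkeletonCode X T D G J L W := by
  obtain ⟨Γ, _, r, hr, rfl⟩ := hA
  choose F hF using fun s => exists_continuousMap_separating (hr.continuous s) (hr.metrizable s)
  -- The index type has no given set-theoretic form, so it is well-ordered and its elements are
  -- replaced by levels of the cumulative hierarchy.
  obtain ⟨i, hi⟩ : ∃ i : Γ → ZFSet.{u}, Function.Injective i :=
    ⟨_, vonNeumann_injective.comp (typein_injective (WellOrderingRel (α := Γ)))⟩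
  -- A limit `o` keeps pairs of points, indices and numbers below `o`. Functions on `K` may have
  -- rank `o` itself, so pairs involving them need the next limit `o + ω`.
  obtain ⟨o, ho, hωo, heo, hio⟩ : ∃ o : Ordinal.{u}, Order.IsSuccLimit o ∧ ω < o ∧
      (∀ x, rank (e x) < o) ∧ ∀ s, rank (i s) < o := by
    refine ⟨max ω (max (rank (range e)) (rank (range i))) + ω,
      isSuccLimit_add _ isSuccLimit_omega0, ?_, fun x => ?_, fun s => ?_⟩
    · exact (le_max_left _ _).trans_lt (lt_add_of_pos_right _ omega0_pos)
    · refine (rank_lt_of_mem (mem_range_self x)).trans_le ?_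
      exact ((le_max_left _ _).trans (le_max_right _ _)).trans le_self_add
    · refine (rank_lt_of_mem (mem_range_self s)).trans_le ?_
      exact ((le_max_right _ _).trans (le_max_right _ _)).trans le_self_add
  have ho' : Order.IsSuccLimit (o + ω) := isSuccLimit_add _ isSuccLimit_omega0
  have hoω : o < o + ω := by simp
  have hnat : ∀ n, rank (natCode.{u} n) < o := fun n => (rank_natCode_lt n).trans hωo
  have hfun : ∀ f : K → ℝ, rank (funCode e f) ≤ o := fun f => ZFSet.rank_range_le fun x =>
    rank_orderedPair_lt ho (heo x) ((rank_realCode_le _).trans_lt hωo)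
  refine ⟨Order.succ (vonNeumann (o + ω + 1)).card, fun θ hθ₀ => ?_⟩
  have hθ : (vonNeumann (o + ω + 1)).card < θ := Order.succ_le_iff.1 hθ₀
  have hF₀ : Fact ((vonNeumann (ω + ω : Ordinal.{u})).card < θ) :=
    ⟨(card_mono (vonNeumann_subset_of_le ((add_le_add_left hωo.le ω).trans le_self_add))).trans_lt
      hθ⟩
  have hH : ∀ {z : ZFSet.{u}}, rank z ≤ o + ω → z ∈ H θ := fun hz =>
    mem_H_of_rank_lt (Order.lt_add_one_iff.2 hz) hθ
  refine ⟨hF₀, fun X T D hX hT hD => ?_⟩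
  have hpt : ∀ y, e y ∈ H θ := fun y => hH ((heo y).trans hoω).le
  have hiH : ∀ s, i s ∈ H θ := fun s => hH ((hio s).trans hoω).le
  let G : H θ := ⟨range i, hH ((ZFSet.rank_range_le hio).trans hoω.le)⟩
  let J : H θ := ⟨range fun p : {p : K × Γ // p.1 ∈ Set.range (r p.2)} =>
    ZFSet.pair (e p.1.1) (i p.1.2),
    hH ((ZFSet.rank_range_le fun p => rank_orderedPair_lt ho (heo _) (hio _)).trans hoω.le)⟩
  let L : H θ := ⟨range fun p : {p : Γ × Γ // p.1 ≤ p.2} => ZFSet.pair (i p.1.1) (i p.1.2),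
    hH ((ZFSet.rank_range_le fun p => rank_orderedPair_lt ho (hio _) (hio _)).trans hoω.le)⟩
  let W : H θ := ⟨range fun p : ℕ × Γ =>
    ZFSet.pair (ZFSet.pair (natCode p.1) (i p.2)) (funCode e (F p.2 p.1)),
    hH (ZFSet.rank_range_le fun p => rank_orderedPair_lt ho'
      ((rank_orderedPair_lt ho (hnat _) (hio _)).trans hoω) ((hfun _).trans_lt hoω))⟩
  let Z : H θ := ⟨range fun p : Γ × ℕ => ZFSet.pair (i p.1) (natCode p.2),
    hH ((ZFSet.rank_range_le fun p => rank_orderedPair_lt ho (hio _) (hnat _)).trans hoω.le)⟩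
  have hmG : ∀ s : H θ, s.1 ∈ G.1 ↔ ∃ t, s.1 = i t := fun s => by
    simp [G, eq_comm]
  have hmJ : ∀ y t, ZFSet.pair (e y) (i t) ∈ J.1 ↔ y ∈ Set.range (r t) := fun y t => by
    simp only [J, mem_range, Subtype.exists, Prod.exists, ZFSet.pair_inj, e.injective.eq_iff,
      hi.eq_iff]
    exact ⟨by rintro ⟨_, _, h, rfl, rfl⟩; exact h, fun h => ⟨y, t, h, rfl, rfl⟩⟩
  have hmL : ∀ s t, ZFSet.pair (i s) (i t) ∈ L.1 ↔ s ≤ t := fun s t => by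
    simp only [L, mem_range, Subtype.exists, Prod.exists, ZFSet.pair_inj, hi.eq_iff]
    exact ⟨by rintro ⟨_, _, h, rfl, rfl⟩; exact h, fun h => ⟨s, t, h, rfl, rfl⟩⟩
  refine ⟨G, J, L, W, fun d hd => ?_, fun a b ha hb => ?_, fun p f f' hf hf' => ?_,
    ⟨Z, fun s n hs hn => ?_⟩, fun Y hYG hYc hYd x y hx hy hxY hyY hxy => ?_⟩
  · rw [hD] at hd
    obtain ⟨y, hy, hdy⟩ := mem_subsetCode.1 hd
    obtain ⟨t, ht⟩ := Set.mem_iUnion.1 hy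
    refine ⟨⟨i t, hiH t⟩, mem_range_self t, ?_⟩
    simp only [pair, hdy]
    exact (hmJ y t).2 ht
  · obtain ⟨s, hs⟩ := (hmG a).1 ha
    obtain ⟨t, ht⟩ := (hmG b).1 hb
    obtain ⟨w, hsw, htw⟩ := hr.directed s t
    refine ⟨⟨i w, hiH w⟩, mem_range_self w, ?_, ?_⟩
    · simp only [pair, hs]
      exact (hmL s w).2 hsw
    · simp only [pair, ht]
      exact (hmL t w).2 htw
  · obtain ⟨q, hq⟩ := mem_range.1 hf
    obtain ⟨q', hq'⟩ := mem_range.1 hf'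
    obtain ⟨h1, h2⟩ := ZFSet.pair_inj.1 hq
    obtain ⟨h1', h2'⟩ := ZFSet.pair_inj.1 hq'
    obtain ⟨h3, h4⟩ := ZFSet.pair_inj.1 (h1.trans h1'.symm)
    have : q = q' := Prod.ext (natCode_injective h3) (hi h4)
    subst this
    exact Subtype.ext (h2.symm.trans h2')
  · obtain ⟨t, ht⟩ := (hmG s).1 hs
    obtain ⟨n, rfl⟩ := mem_omega.1 hn
    exact mem_range.2 ⟨(t, n), by rw [← ht]; rfl⟩
  · obtain ⟨x, hxH⟩ := x
    obtain ⟨y, hyH⟩ := y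
    simp only [hX, mem_subsetCode, Set.mem_univ, true_and] at hx hy
    obtain ⟨x, rfl⟩ := hx
    obtain ⟨y, rfl⟩ := hy
    set S : Set Γ := {s | i s ∈ Y.1} with hS
    have hYi : ∀ s : H θ, s.1 ∈ Y.1 → ∃ t ∈ S, s.1 = i t := fun s hs => by
      obtain ⟨t, ht⟩ := (hmG s).1 (hYG s hs)
      exact ⟨t, by simpa [hS, ← ht] using hs, ht⟩
    have hSc : S.Countable := by
      obtain ⟨g, hg⟩ := hYc
      have hg' : ∀ s : S, ∃ n : ℕ, (pair ⟨i s, hiH s⟩ (nat n)).1 ∈ g.1 ∧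
          ∀ s' : H θ, (pair s' (nat n)).1 ∈ g.1 → s' = ⟨i s, hiH s⟩ := fun s => by
        obtain ⟨n, hn, h⟩ := hg ⟨i s, hiH s⟩ s.2
        obtain ⟨n, rfl⟩ := mem_omega.1 hn
        exact ⟨n, h⟩
      choose k hk hk' using hg'
      refine Set.countable_coe_iff.1 (Function.Injective.countable (f := k) fun s t hst => ?_)
      have := hk' t ⟨i s, hiH s⟩ (hst ▸ hk s)
      exact Subtype.ext (hi (congrArg Subtype.val this))
    have hSd : DirectedOn (· ≤ ·) S := by
      intro s hs t ht
      obtain ⟨c, hc, hsc, htc⟩ := hYd ⟨i s, hiH s⟩ ⟨i t, hiH t⟩ hs ht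
      obtain ⟨w, hw, hcw⟩ := hYi c hc
      simp only [pair, hcw] at hsc htc
      exact ⟨w, hw, (hmL _ _).1 hsc, (hmL _ _).1 htc⟩
    have hcl : ∀ x hx, InClosure T D J Y ⟨e x, hx⟩ →
        x ∈ closure {d | ∃ s ∈ S, d ∈ Set.range (r s)} := by
      intro x hx hxY
      refine mem_closure_iff.2 fun O hO hxO => ?_
      have hU : subsetCode e O ∈ T.1 := hT ▸ mem_range.2 ⟨⟨O, hO⟩, rfl⟩
      obtain ⟨d, hdD, hdU, s, hs, hds⟩ := hxY ⟨_, mem_H_of_mem T.2 hU⟩ hU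
        (apply_mem_subsetCode.2 hxO)
      obtain ⟨d', hd', hdd'⟩ := mem_subsetCode.1 hdU
      obtain ⟨t, ht, hst⟩ := hYi s hs
      simp only [pair, hdd', hst] at hds
      exact ⟨d', hd', t, ht, (hmJ _ _).1 hds⟩
    -- Here the topology of the skeleton enters: the limit argument makes some retraction with index
    -- in `S` distinguish `x` from `y`.
    have hex : ∃ s ∈ S, r s x ≠ r s y := by
      by_contra! h
      refine hxy (Subtype.ext (congrArg e ?_))
      exact hr.eq_of_forall_apply_eq hSc hSd (hcl x _ hxY) (hcl y _ hyY) h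
    obtain ⟨s, hs, hne⟩ := hex
    obtain ⟨n, hn⟩ := not_forall.1 (mt (hF s x y) hne)
    have hfH : funCode e (F s n) ∈ H θ := hH ((hfun _).trans hoω.le)
    refine ⟨⟨i s, hiH s⟩, nat n, ⟨_, hfH⟩, ⟨hs, nat_mem_omega n⟩, mem_range.2 ⟨(n, s), rfl⟩,
      (isCont_iff hX hT).2 ⟨F s n, rfl⟩, real (F s n x), real (F s n y),
      pair_mem_funCode.2 ⟨x, rfl, rfl⟩, pair_mem_funCode.2 ⟨y, rfl, rfl⟩, fun h => ?_⟩
    exact hn (real_injective h)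

end HSet

theorem IsInducedByRetractionalSkeleton.exists_injOn {K : Type u} [TopologicalSpace K]
    [CompactSpace K] [T2Space K] (e : K ↪ ZFSet.{u}) {D : Set K}
    (hD : IsInducedByRetractionalSkeleton D) :
    ∃ θ₀ : Cardinal.{u}, ∀ θ : Cardinal.{u}, θ₀ ≤ θ →
      ∀ M : setTheoryLanguage.ElementarySubstructure (ZFSet.H θ),
        (modelSets M).Countable →
        ZFSet.spaceCode e ∈ modelSets M → ZFSet.subsetCode e D ∈ modelSets M →
          Set.InjOn (modelQuotientMap M e) (closure (modelPoints M e D)) := by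
  obtain ⟨θ₀, h⟩ := HSet.exists_isSkeletonCode e hD
  refine ⟨θ₀, fun θ hθ M hM hsp hDM => ?_⟩
  obtain ⟨_, h⟩ := h θ hθ
  obtain ⟨hspH, hsp⟩ := hsp
  obtain ⟨hDH, hDM⟩ := hDM
  have hpair : ∀ z ∈ ({ZFSet.subsetCode e Set.univ,
      ZFSet.range fun U : TopologicalSpace.Opens K => ZFSet.subsetCode e U} : ZFSet.{u}),
      z ∈ ZFSet.H θ := fun z hz => ZFSet.mem_H_of_mem
    (ZFSet.mem_H_of_mem hspH (ZFSet.mem_pair.2 (Or.inr rfl))) hz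
  let X : ZFSet.H θ := ⟨_, hpair _ (ZFSet.mem_pair.2 (Or.inl rfl))⟩
  let T : ZFSet.H θ := ⟨_, hpair _ (ZFSet.mem_pair.2 (Or.inr rfl))⟩
  obtain ⟨hXM, hTM⟩ : X ∈ M ∧ T ∈ M := HSet.mem_of_pair_mem hsp
  have hdef := fun {V : Type} {a b c d : (V → ZFSet.H θ) → ZFSet.H θ} =>
    HSet.definablePred_isSkeletonCode (M := M) (a := a) (b := b) (c := c) (d := d) hXM hTM hDM
  -- The witnesses are moved into `M` one at a time, each becoming a parameter for the next.
  obtain ⟨G, hG, hex⟩ := DefinablePred.exists_mem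
    (.ex (.ex (.ex (hdef (.var _) (.var _) (.var _) (.var _))))) (h X T ⟨_, hDH⟩ rfl rfl rfl)
  obtain ⟨J, hJ, hex⟩ := DefinablePred.exists_mem
    (.ex (.ex (hdef (.const hG) (.var _) (.var _) (.var _)))) hex
  obtain ⟨L, hL, hex⟩ := DefinablePred.exists_mem
    (.ex (hdef (.const hG) (.const hJ) (.var _) (.var _))) hex
  obtain ⟨W, hW, hcode⟩ := DefinablePred.exists_mem
    (hdef (.const hG) (.const hJ) (.const hL) (.var _)) hex
  exact HSet.injOn_of_isSkeletonCode rfl rfl rfl hG hJ hL hW hM hcode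

/-! ### Retractional skeletons from systems of separating families -/

section Topology

variable {K : Type u} [TopologicalSpace K] [CompactSpace K] [T2Space K]

omit [T2Space K] in
-- The graph of `ρ` is cut out by closed conditions, and projecting along the compact factor is a
-- closed map, so preimages of closed sets are closed.
theorem continuous_of_forall_apply_eq {S : Set K} (hS : IsClosed S) {F : Set C(K, ℝ)} {ρ : K → K}
    (hρS : ∀ x, ρ x ∈ S) (hρ : ∀ x, ∀ f ∈ F, f (ρ x) = f x)
    (hinj : ∀ x ∈ S, ∀ y ∈ S, (∀ f ∈ F, f x = f y) → x = y) : Continuous ρ := by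
  refine continuous_iff_isClosed.2 fun C hC => ?_
  have h : ρ ⁻¹' C = Prod.fst '' {p : K × K | p.2 ∈ C ∩ S ∧ ∀ f ∈ F, f p.2 = f p.1} := by
    ext x
    constructor
    · exact fun hx => ⟨(x, ρ x), ⟨⟨hx, hρS x⟩, hρ x⟩, rfl⟩
    · rintro ⟨⟨x, y⟩, ⟨⟨hyC, hyS⟩, hy⟩, rfl⟩
      have : ρ x = y := hinj _ (hρS x) _ hyS fun f hf => (hρ x f hf).trans (hy f hf).symm
      exact this.symm ▸ hyC
  rw [h]
  refine isClosedMap_fst_of_compactSpace _ (((hC.inter hS).preimage continuous_snd).inter ?_)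
  have h' : {p : K × K | ∀ f ∈ F, f p.2 = f p.1} = ⋂ f ∈ F, {p : K × K | f p.2 = f p.1} := by
    ext p; simp
  exact (congrArg IsClosed h').mpr <| isClosed_biInter fun f _ =>
    isClosed_eq (f.continuous.comp continuous_snd) (f.continuous.comp continuous_fst)

omit [T2Space K] in
theorem metrizableSpace_of_countable_separating {S : Set K} (hS : IsClosed S) {F : Set C(K, ℝ)}
    (hF : F.Countable) (hinj : ∀ x ∈ S, ∀ y ∈ S, (∀ f ∈ F, f x = f y) → x = y) :
    TopologicalSpace.MetrizableSpace S := by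
  have : Countable F := hF
  have : CompactSpace S := isCompact_iff_compactSpace.1 hS.isCompact
  let φ : S → F → ℝ := fun x f => f.1 x
  have hφ : Continuous φ := continuous_pi fun f => f.1.continuous.comp continuous_subtype_val
  have hi : Function.Injective φ := fun x y h =>
    Subtype.ext (hinj _ x.2 _ y.2 fun f hf => congrFun h ⟨f, hf⟩)
  exact (hφ.isClosedEmbedding hi).isEmbedding.metrizableSpace

omit [T2Space K] in
-- By compactness it suffices to identify cluster points. Each lies in `S` and agrees with `y` under
-- every `f ∈ F`, so it equals `y`.
theorem tendsto_of_eventually_apply_eq {S : Set K} (hS : IsClosed S) {F : Set C(K, ℝ)}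
    (hinj : ∀ x ∈ S, ∀ y ∈ S, (∀ f ∈ F, f x = f y) → x = y) {ι : Type*} {l : Filter ι}
    {u : ι → K} {y : K} (hu : ∀ᶠ i in l, u i ∈ S) (hy : y ∈ S)
    (huy : ∀ f ∈ F, ∀ᶠ i in l, f (u i) = f y) : Tendsto u l (𝓝 y) := by
  refine tendsto_nhds_of_unique_mapClusterPt fun z hz => ?_
  refine hinj _ (hS.mem_of_mapClusterPt hz hu) _ hy fun f hf => ?_
  have h := hz.continuousAt_comp (f.continuous.continuousAt (x := z))
  exact isClosed_singleton.mem_of_mapClusterPt h (huy f hf)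

theorem eq_of_forall_continuousMap_eq {x y : K} (h : ∀ f : C(K, ℝ), f x = f y) : x = y := by
  by_contra hne
  obtain ⟨f, hf0, hf1, -⟩ := exists_continuous_zero_one_of_isClosed
    (isClosed_singleton (x := x)) (isClosed_singleton (x := y)) (by simpa using hne)
  have h0 : f x = 0 := hf0 rfl
  have h1 : f y = 1 := hf1 rfl
  exact zero_ne_one (h0.symm.trans ((h f).trans h1))

/-- Abstract form of the construction: `A s` and `F s` stand for the points of `D` and the
continuous functions in a model. Both limit conditions hold because `f (r s x) = f x` as soon as `f
∈ F s`. -/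
theorem exists_isRetractionalSkeleton {Γ : Type v} [PartialOrder Γ] (hne : Nonempty Γ)
    (hdir : ∀ s t : Γ, ∃ w, s ≤ w ∧ t ≤ w) (A : Γ → Set K) (F : Γ → Set C(K, ℝ))
    (hA : Monotone A) (hF : Monotone F) (hFc : ∀ s, (F s).Countable)
    (hinj : ∀ s, ∀ x ∈ closure (A s), ∀ y ∈ closure (A s), (∀ f ∈ F s, f x = f y) → x = y)
    (hsurj : ∀ s x, ∃ y ∈ closure (A s), ∀ f ∈ F s, f y = f x)
    (hcof : ∀ f, ∃ s, f ∈ F s)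
    (hsup : ∀ s : ℕ → Γ, StrictMono s → ∃ t, IsLUB (Set.range s) t ∧
      F t ⊆ ⋃ n, F (s n)) :
    ∃ r : Γ → K → K, IsRetractionalSkeleton r ∧ ∀ s, Set.range (r s) = closure (A s) := by
  choose r hrA hrF using hsurj
  have hfix : ∀ s, ∀ x ∈ closure (A s), r s x = x := fun s x hx =>
    hinj s _ (hrA s x) _ hx (hrF s x)
  have hrange : ∀ s, Set.range (r s) = closure (A s) := fun s =>
    Set.Subset.antisymm (Set.range_subset_iff.2 (hrA s)) fun x hx => ⟨x, hfix s x hx⟩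
  refine ⟨r, ⟨hne, hdir, fun s => ?_, fun s x => hfix s _ (hrA s x), fun s => ?_, fun s t hst => ?_,
    fun x => ?_, fun s hs => ?_⟩, hrange⟩
  · exact continuous_of_forall_apply_eq isClosed_closure (hrA s) (hrF s) (hinj s)
  · rw [hrange]
    exact metrizableSpace_of_countable_separating isClosed_closure (hFc s) (hinj s)
  · refine ⟨funext fun x => ?_, funext fun x => ?_⟩
    · refine hinj s _ (hrA s x) _ (hrA s _) fun f hf => ?_
      rw [Function.comp_apply, hrF s _ f hf, hrF s _ f hf, hrF t _ f (hF hst hf)]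
    · exact (hfix t _ (closure_mono (hA hst) (hrA s x))).symm
  · refine tendsto_of_eventually_apply_eq isClosed_univ (F := Set.univ)
      (fun x _ y _ h => eq_of_forall_continuousMap_eq fun f => h f trivial)
      (Eventually.of_forall fun _ => trivial) trivial fun f _ => ?_
    obtain ⟨s, hs⟩ := hcof f
    exact (eventually_ge_atTop s).mono fun t hst => hrF t x f (hF hst hs)
  · obtain ⟨t, ht, hFt⟩ := hsup s hs
    refine ⟨t, ht, fun x => tendsto_of_eventually_apply_eq isClosed_closure (hinj t)
      (Eventually.of_forall fun n => closure_mono (hA (ht.1 ⟨n, rfl⟩)) (hrA _ x)) (hrA t x)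
      fun f hf => ?_⟩
    obtain ⟨n, hn⟩ := Set.mem_iUnion.1 (hFt hf)
    refine (eventually_ge_atTop n).mono fun m hnm => ?_
    rw [hrF _ x f (hF (hs.monotone hnm) hn), hrF t x f hf]

end Topology

/-! ### Existence of elementary substructures -/

section Existence

open FirstOrder FirstOrder.Language Cardinal

variable {θ : Cardinal.{u}}

theorem card_setTheoryLanguage_le : setTheoryLanguage.card ≤ ℵ₀ := by
  have h1 : ∀ l, IsEmpty (setTheoryLanguage.Functions l) := fun _ =>
    inferInstanceAs (IsEmpty Empty)
  have h2 : ∀ l, Subsingleton (setTheoryLanguage.Relations l) := fun _ =>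
    ⟨fun a b => by cases a; cases b; rfl⟩
  have h3 : ∀ l, Countable (setTheoryLanguage.Relations l) := fun l => inferInstance
  have h4 : Countable setTheoryLanguage.Symbols := inferInstanceAs (Countable (_ ⊕ _))
  exact mk_le_aleph0

theorem modelSets_eq_image (M : setTheoryLanguage.ElementarySubstructure (ZFSet.H θ)) :
    modelSets M = Subtype.val '' (M : Set (ZFSet.H θ)) := by
  ext x
  exact ⟨fun ⟨h, hM⟩ => ⟨⟨x, h⟩, hM, rfl⟩, fun ⟨y, hy, hyx⟩ => hyx ▸ ⟨y.2, hy⟩⟩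

theorem exists_countable_elementarySubstructure [Infinite (ZFSet.H θ)] {s : Set (ZFSet.H θ)}
    (hs : s.Countable) : ∃ M : setTheoryLanguage.ElementarySubstructure (ZFSet.H θ),
      s ⊆ M ∧ (modelSets M).Countable := by
  obtain ⟨M, hsM, hM⟩ := exists_elementarySubstructure_card_eq setTheoryLanguage s
    (ℵ₀ : Cardinal.{0}) le_rfl (by simpa using hs.le_aleph0)
    (by simpa using card_setTheoryLanguage_le) (by simp)
  refine ⟨M, hsM, ?_⟩
  rw [modelSets_eq_image]
  refine Set.Countable.image (le_aleph0_iff_set_countable.1 ?_) _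
  have hM' : lift.{0} #M = lift.{u + 1} (ℵ₀ : Cardinal.{0}) := hM
  rw [lift_aleph0, Cardinal.lift_uzero] at hM'
  exact hM'.le

theorem exists_elementarySubstructure_eq_iUnion
    {M : ℕ → setTheoryLanguage.ElementarySubstructure (ZFSet.H θ)} (hM : Monotone M) :
    ∃ N : setTheoryLanguage.ElementarySubstructure (ZFSet.H θ),
      (N : Set (ZFSet.H θ)) = ⋃ n, (M n : Set (ZFSet.H θ)) := by
  have h : setTheoryLanguage.MeetsDefinable (⋃ n, (M n : Set (ZFSet.H θ))) := by
    intro D hD hdef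
    -- A formula uses finitely many parameters, so all of them lie in one `M n`, and the
    -- Tarski–Vaught test for that model gives a witness.
    obtain ⟨A₀, hA₀, hdef⟩ := Set.definable_iff_finitely_definable.1 hdef
    have hdir : Directed (· ⊆ ·) fun n => (M n : Set (ZFSet.H θ)) :=
      Monotone.directed_le fun m n hmn => hM hmn
    obtain ⟨n, hn⟩ := hdir.exists_mem_subset_of_finset_subset_biUnion hA₀
    obtain ⟨x, hxD, hx⟩ := (M n).meetsDefinable D hD (hdef.mono hn)
    exact ⟨x, hxD, Set.mem_iUnion.2 ⟨n, hx⟩⟩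
  exact ⟨h.toElementarySubstructure, h.closure_eq_self⟩

end Existence

/-! ### The system of retractions given by countable elementary substructures -/

section Models

open HSet ZFSet Ordinal

variable {θ : Cardinal.{u}} [hθ : Fact ((vonNeumann (ω + ω : Ordinal.{u})).card < θ)]
  {K : Type u} [TopologicalSpace K] {e : K ↪ ZFSet.{u}}

instance HSet.infinite : Infinite (H θ) :=
  Infinite.of_injective HSet.nat fun _ _ h => nat_inj.1 h

/-- The continuous functions which are elements of `M`. -/
def modelFunctions (M : setTheoryLanguage.ElementarySubstructure (H θ)) (e : K ↪ ZFSet.{u}) :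
    Set C(K, ℝ) :=
  {f | funCode e f ∈ modelSets M}

omit hθ in
theorem countable_modelFunctions {M : setTheoryLanguage.ElementarySubstructure (H θ)}
    (hM : (modelSets M).Countable) : (modelFunctions M e).Countable :=
  Set.Countable.preimage_of_injOn hM
    (Function.Injective.injOn (funCode_injective.comp DFunLike.coe_injective))

omit hθ in
theorem mem_modelSets {M : setTheoryLanguage.ElementarySubstructure (H θ)} {x : H θ} :
    x.1 ∈ modelSets M ↔ x ∈ M :=
  ⟨fun ⟨_, h⟩ => h, fun h => ⟨x.2, h⟩⟩

/-- A finite set of rational bounds on functions in `M` is definable over `M`, so a point of `D`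
meeting them can be replaced by one in `D ∩ M`. The upper bound becomes weak because a rational
outside the cut of `a` is only known to be at least `a`. -/
theorem exists_mem_modelPoints {M : setTheoryLanguage.ElementarySubstructure (H θ)} {D : Set K}
    (hD : subsetCode e D ∈ modelSets M) {ι : Type*} (u : Finset ι) (f : ι → C(K, ℝ))
    (p q : ι → ℚ) (hf : ∀ i, f i ∈ modelFunctions M e) {a : K} (ha : a ∈ D)
    (hpa : ∀ i ∈ u, p i < f i a) (haq : ∀ i ∈ u, f i a < q i) :
    ∃ b ∈ modelPoints M e D, ∀ i ∈ u, p i ≤ f i b ∧ f i b ≤ q i := by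
  obtain ⟨hDH, hDM⟩ := hD
  have hfH : ∀ i, funCode e (f i) ∈ H θ := fun i => (hf i).1
  have haD : e a ∈ subsetCode e D := apply_mem_subsetCode.2 ha
  obtain ⟨z, hzM, hzD, hz⟩ := DefinablePred.exists_mem (M := M)
    (R := fun z => z.1 ∈ (⟨subsetCode e D, hDH⟩ : H θ).1 ∧ ∀ i ∈ u, ∃ c : H θ,
      (HSet.pair z c).1 ∈ (⟨funCode e (f i), hfH i⟩ : H θ).1 ∧ (HSet.rat (p i)).1 ∈ c.1 ∧
        ¬ (HSet.rat (q i)).1 ∈ c.1)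
    (.and (.mem (.var _) (.const hDM)) <| .forall_finset u fun i _ => .ex <|
      .and (.mem (definableTerm_pair (.var _) (.var _)) (.const (hf i).2)) <|
      .and (.mem (.const (rat_mem _)) (.var _)) (.not (.mem (.const (rat_mem _)) (.var _))))
    ⟨⟨e a, mem_H_of_mem hDH haD⟩, haD, fun i hi => ⟨HSet.real (f i a),
      pair_mem_funCode.2 ⟨a, rfl, rfl⟩, rat_mem_real.2 (hpa i hi),
      fun h => (haq i hi).not_gt (rat_mem_real.1 h)⟩⟩
  obtain ⟨b, hb, hzb⟩ := mem_subsetCode.1 hzD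
  refine ⟨b, ⟨hb, hzb ▸ mem_modelSets.2 hzM⟩, fun i hi => ?_⟩
  obtain ⟨c, hc, hpc, hqc⟩ := hz i hi
  obtain ⟨y, hy, rfl⟩ := pair_mem_funCode.1 hc
  obtain rfl : b = y := e.injective (hzb.symm.trans hy)
  exact ⟨(rat_mem_real.1 hpc).le, not_lt.1 fun h => hqc (rat_mem_real.2 h)⟩

theorem exists_mem_closure_modelPoints [CompactSpace K]
    {M : setTheoryLanguage.ElementarySubstructure (H θ)} {D : Set K} (hdense : Dense D)
    (hD : subsetCode e D ∈ modelSets M) (x : K) :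
    ∃ y ∈ closure (modelPoints M e D), ∀ f ∈ modelFunctions M e, f y = f x := by
  -- The indices are all rational intervals around values `f x` with `f` in `M`. The finite
  -- intersection property for the corresponding closed sets yields a `y` that no such interval
  -- tells apart from `x`.
  let ι := {i : C(K, ℝ) × ℚ × ℚ // i.1 ∈ modelFunctions M e ∧ i.2.1 < i.1 x ∧ i.1 x < i.2.2}
  obtain ⟨y, hy, hyt⟩ := isClosed_closure.isCompact.inter_iInter_nonempty
    (s := closure (modelPoints M e D))
    (fun i : ι => {y | (i.1.2.1 : ℝ) ≤ i.1.1 y ∧ i.1.1 y ≤ i.1.2.2})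
    (fun i => (isClosed_le continuous_const i.1.1.continuous).inter
      (isClosed_le i.1.1.continuous continuous_const)) fun u => by
    have hO : IsOpen (⋂ i ∈ u, {y | (i.1.2.1 : ℝ) < i.1.1 y ∧ i.1.1 y < i.1.2.2}) :=
      isOpen_biInter_finset fun i _ => (isOpen_lt continuous_const i.1.1.continuous).inter
        (isOpen_lt i.1.1.continuous continuous_const)
    obtain ⟨a, haO, ha⟩ := hdense.inter_open_nonempty _ hO
      ⟨x, Set.mem_iInter₂.2 fun i _ => i.2.2⟩
    have haO' := Set.mem_iInter₂.1 haO
    obtain ⟨b, hb, hbu⟩ := exists_mem_modelPoints hD u (fun i => i.1.1) (fun i => i.1.2.1)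
      (fun i => i.1.2.2) (fun i => i.2.1) ha (fun i hi => (haO' i hi).1) fun i hi => (haO' i hi).2
    exact ⟨b, subset_closure hb, Set.mem_iInter₂.2 hbu⟩
  refine ⟨y, hy, fun f hf => le_antisymm (le_of_forall_gt fun c hc => ?_)
    (le_of_forall_lt fun c hc => ?_)⟩
  · obtain ⟨q, hq, hqc⟩ := exists_rat_btwn hc
    obtain ⟨p, hp⟩ := exists_rat_lt (f x)
    exact (Set.mem_iInter.1 hyt ⟨(f, p, q), hf, hp, hq⟩).2.trans_lt hqc
  · obtain ⟨p, hcp, hp⟩ := exists_rat_btwn hc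
    obtain ⟨q, hq⟩ := exists_rat_gt (f x)
    exact hcp.trans_le (Set.mem_iInter.1 hyt ⟨(f, p, q), hf, hp, hq⟩).1

theorem isInducedByRetractionalSkeleton_of_injOn [CompactSpace K] [T2Space K] {D : Set K}
    (hdense : Dense D) (hDc : IsCountablyClosed D) (hsp : spaceCode e ∈ H θ)
    (hDH : subsetCode e D ∈ H θ) (hpt : ∀ x, e x ∈ H θ) (hfun : ∀ f : C(K, ℝ), funCode e f ∈ H θ)
    (h : ∀ M : setTheoryLanguage.ElementarySubstructure (H θ), (modelSets M).Countable →
      spaceCode e ∈ modelSets M → subsetCode e D ∈ modelSets M →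
        Set.InjOn (modelQuotientMap M e) (closure (modelPoints M e D))) :
    IsInducedByRetractionalSkeleton D := by
  -- Models are collections of sets and live one universe too high. Since `H(θ)` is small, each is
  -- represented by a subset of a copy of `H(θ)` in universe `u`, as the index type of a skeleton
  -- requires.
  let σ := equivShrink.{u} (H θ)
  let Good : Set (Shrink.{u} (H θ)) → setTheoryLanguage.ElementarySubstructure (H θ) → Prop :=
    fun s M => (modelSets M).Countable ∧ (⟨_, hsp⟩ : H θ) ∈ M ∧ (⟨_, hDH⟩ : H θ) ∈ M ∧
      ∀ x, σ x ∈ s ↔ x ∈ M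
  let Γ := {s : Set (Shrink.{u} (H θ)) // ∃ M, Good s M}
  choose N hNc hNsp hND hN using fun s : Γ => s.2
  have hle : ∀ s t : Γ, s ≤ t ↔ N s ≤ N t := fun s t => by
    constructor
    · exact fun hst x hx => (hN t x).1 (hst ((hN s x).2 hx))
    · intro hst z hz
      obtain ⟨x, rfl⟩ := σ.surjective z
      exact (hN t x).2 (hst ((hN s x).1 hz))
  have hmk : ∀ M : setTheoryLanguage.ElementarySubstructure (H θ), (modelSets M).Countable →
      (⟨_, hsp⟩ : H θ) ∈ M → (⟨_, hDH⟩ : H θ) ∈ M → ∃ s : Γ, N s = M := by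
    intro M hMc hMsp hMD
    have hG : Good (σ.symm ⁻¹' M) M := ⟨hMc, hMsp, hMD, fun x => by simp⟩
    refine ⟨⟨_, M, hG⟩, SetLike.ext fun x => ?_⟩
    rw [← hN, ← hG.2.2.2]
  have hex : ∀ A : Set (H θ), A.Countable → ∃ s : Γ, A ⊆ N s := by
    intro A hA
    obtain ⟨M, hM, hMc⟩ := exists_countable_elementarySubstructure
      ((hA.insert (⟨_, hDH⟩ : H θ)).insert (⟨_, hsp⟩ : H θ))
    obtain ⟨s, hs⟩ := hmk M hMc (hM (by simp)) (hM (by simp))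
    exact ⟨s, fun x hx => hs ▸ hM (by simp [hx])⟩
  have hmono : ∀ {s t : Γ}, s ≤ t → modelSets (N s) ⊆ modelSets (N t) :=
    fun hst x ⟨hx, hxM⟩ => ⟨hx, (hle _ _).1 hst hxM⟩
  have hcount : ∀ s, (N s : Set (H θ)).Countable := fun s => by
    have := hNc s
    rw [modelSets_eq_image] at this
    exact Set.countable_of_injective_of_countable_image Subtype.val_injective.injOn this
  obtain ⟨r, hr, hrange⟩ := exists_isRetractionalSkeleton (Γ := Γ)
    (hne := (hex ∅ Set.countable_empty).nonempty)
    (hdir := fun s t => by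
      obtain ⟨w, hw⟩ := hex _ ((hcount s).union (hcount t))
      exact ⟨w, (hle _ _).2 (Set.subset_union_left.trans hw),
        (hle _ _).2 (Set.subset_union_right.trans hw)⟩)
    (A := fun s => modelPoints (N s) e D) (F := fun s => modelFunctions (N s) e)
    (hA := fun s t hst x hx => ⟨hx.1, hmono hst hx.2⟩)
    (hF := fun s t hst f hf => hmono hst hf)
    (hFc := fun s => countable_modelFunctions (hNc s))
    (hinj := fun s x hx y hy hxy => h (N s) (hNc s) ⟨hsp, hNsp s⟩ ⟨hDH, hND s⟩ hx hy
      (Quotient.sound hxy))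
    (hsurj := fun s x => exists_mem_closure_modelPoints hdense ⟨hDH, hND s⟩ x)
    (hcof := fun f => by
      obtain ⟨s, hs⟩ := hex {⟨_, hfun f⟩} (Set.countable_singleton _)
      exact ⟨s, hfun f, hs rfl⟩)
    (hsup := fun s hs => by
      obtain ⟨M, hM⟩ := exists_elementarySubstructure_eq_iUnion (M := fun n => N (s n))
        fun m n hmn => (hle _ _).1 (hs.monotone hmn)
      have hmM : ∀ x, x ∈ M ↔ ∃ n, x ∈ N (s n) := fun x => by
        rw [← SetLike.mem_coe, hM]; simp
      have hMc : (modelSets M).Countable := by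
        rw [modelSets_eq_image, hM]
        exact (Set.countable_iUnion fun n => hcount _).image _
      obtain ⟨t, rfl⟩ := hmk M hMc ((hmM _).2 ⟨0, hNsp _⟩) ((hmM _).2 ⟨0, hND _⟩)
      refine ⟨t, ⟨?_, fun w hw => (hle _ _).2 fun x hx => ?_⟩, fun f hf => ?_⟩
      · rintro _ ⟨n, rfl⟩
        exact (hle _ _).2 fun x hx => (hmM x).2 ⟨n, hx⟩
      · obtain ⟨n, hn⟩ := (hmM x).1 hx
        exact (hle _ _).1 (hw ⟨n, rfl⟩) hn
      · obtain ⟨hfH, hf⟩ := hf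
        obtain ⟨n, hn⟩ := (hmM _).1 hf
        exact Set.mem_iUnion.2 ⟨n, hfH, hn⟩)
  refine ⟨Γ, inferInstance, r, hr, Set.Subset.antisymm (fun x hx => ?_) ?_⟩
  · obtain ⟨s, hs⟩ := hex {⟨_, hpt x⟩} (Set.countable_singleton _)
    refine Set.mem_iUnion.2 ⟨s, ?_⟩
    rw [hrange]
    exact subset_closure ⟨hx, hpt x, hs rfl⟩
  -- Only here is countable closedness used: the range of `r s` is the closure of a countable subset
  -- of `D`.
  · refine Set.iUnion_subset fun s => ?_
    rw [hrange]
    exact hDc _ (fun x hx => hx.1)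
      (Set.Countable.preimage_of_injOn (hNc s) e.injective.injOn |>.mono fun x hx => hx.2)

end Models

/-! ### The equivalence -/

theorem mainTheorem10 {K : Type u} [TopologicalSpace K] [CompactSpace K] [T2Space K]
    (e : K ↪ ZFSet.{u}) (D : Set K) (hD : Dense D) (hDc : IsCountablyClosed D) :
    IsInducedByRetractionalSkeleton D ↔
      ∃ θ₀ : Cardinal.{u}, ∀ θ : Cardinal.{u}, θ₀ ≤ θ →
        ∀ M : setTheoryLanguage.ElementarySubstructure (ZFSet.H θ),
          (modelSets M).Countable →
          ZFSet.spaceCode e ∈ modelSets M → ZFSet.subsetCode e D ∈ modelSets M →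
            Set.InjOn (modelQuotientMap M e) (closure (modelPoints M e D)) := by
  refine ⟨fun h => h.exists_injOn e, fun ⟨θ₀, h⟩ => ?_⟩
  let S : Set ZFSet.{u} := insert (ZFSet.spaceCode e) (insert (ZFSet.subsetCode e D)
    (Set.range e ∪ Set.range fun f : C(K, ℝ) => ZFSet.funCode e f))
  -- A single `θ` is enough, provided that `H(θ)` contains the codes of `K` and `D`, all points and
  -- all continuous functions; the latter two make the family of models exhaust `D` and `C(K)`.
  obtain ⟨o, ho⟩ : BddAbove (ZFSet.rank '' S) := Ordinal.bddAbove_of_small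
  let κ : Cardinal.{u} :=
    (ZFSet.vonNeumann (max (Ordinal.omega0 + Ordinal.omega0) (o + 1))).card
  have hκ : κ < max θ₀ (Order.succ κ) := (Order.lt_succ κ).trans_le (le_max_right _ _)
  have : Fact ((ZFSet.vonNeumann (Ordinal.omega0 + Ordinal.omega0 : Ordinal.{u})).card <
      max θ₀ (Order.succ κ)) :=
    ⟨(ZFSet.card_mono (ZFSet.vonNeumann_subset_of_le (le_max_left _ _))).trans_lt hκ⟩
  have hH : ∀ z ∈ S, z ∈ ZFSet.H (max θ₀ (Order.succ κ)) := fun z hz =>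
    ZFSet.mem_H_of_rank_lt (lt_max_of_lt_right (Order.lt_add_one_iff.2 (ho ⟨z, hz, rfl⟩))) hκ
  exact isInducedByRetractionalSkeleton_of_injOn hD hDc (hH _ (by simp [S])) (hH _ (by simp [S]))
    (fun x => hH _ (by simp [S])) (fun f => hH _ (by simp [S])) (h _ (le_max_left _ _))
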